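/- Let $f$ be the probability distribution on $\{1,2,3,\dots\}$ with $f_{4^{4^n}}=2^{-n}$ for $n\ge 1$ and $f_k=0$ for all other $k$. For $I=\mathbb N=\{0,1,2,\dots\}$ and for $I=\mathbb Z$ let $\Omega_I=\{1,2,3,\dots\}^{I}$, with the product measure $P_I=f^{I}$ and the shift $(S\omega)_i=\omega_{i+1}$, and let $(X_I,m_I,T_I)$ be the tower over $(\Omega_I,P_I,S)$ with height function $\omega\mapsto\omega_0$: that is, $X_I=\{(\omega,j):\omega\in\Omega_I,\ 0\le j<\omega_0\}$, $m_I$ is the restriction to $X_I$ of $P_I\times$ counting measure, $T_I(\omega,j)=(\omega,j+1)$ if $j+1<\omega_0$, and $T_I(\omega,\omega_0-1)=(S\omega,0)$. Definitions. Let $T$ be a conservative, ergodic, measure preserving transformation of a $\sigma$-finite measure space $(X,m)$. For a measurable set $A$ with $0<m(A)<\infty$ let $\varphi_A(x)=\min\{n\ge1:T^nx\in A\}$ for $x\in A$. $T$ is *quasi finite* if for some such $A$ the partition $\{A\cap[\varphi_A=n]:n\ge1\}$ of $A$ has finite entropy with respect to the probability $m(\,\cdot\,|A)$. $T$ is *log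 lower bounded* (LLB) if $\int_A\log\varphi_A\,dm<\infty$ for some such $A$. $T$ is *pointwise dual ergodic with return sequence* $(a_n)_{n\ge 1}$, $a_n>0$, if $\frac1{a_n}\sum_{k=0}^{n-1}\widehat T^kf\to\int_X f\,dm$ almost everywhere for some integrable $f\ge0$ with $\int_X f\,dm>0$, where $\widehat T$ is the transfer operator on $L^1(m)$, defined by $\int_A\widehat Tf\,dm=\int_{T^{-1}A}f\,dm$. A (one-sided if $I=\mathbb N$, two-sided if $I=\mathbb Z$) *Markov shift* is a system isomorphic, modulo null sets, to the shift on $\mathcal S^{I}$, $\mathcal S$ a countable set, with the Markov measure given by a stochastic matrix on $\mathcal S$ and a stationary, possibly infinite, measure with finite mass at each state. $a_n\asymp b_n$ means that $a_n/b_n$ is bounded above and bounded away from $0$ for all large $n$. Claim. (1) $(X_{\mathbb N},m_{\mathbb N},T_{\mathbb N})$ is a $\sigma$-finite, conservative, ergodic, measure preserving one-sided Markov shift; it is quasi finite; it is pointwise dual ergodic with a return sequence $a_n\asymp\sqrt{\log n}$; and it is not LLB. (2) $(X_{\mathbb Z},m_{\mathbb Z},T_{\mathbb Z})$ is a $\sigma$-finite,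 conservative, ergodic, measure preserving two-sided Markov shift; it is quasi finite; it has the one-sided tower $(X_{\mathbb N},m_{\mathbb N},T_{\mathbb N})$ of (1) as a factor; and it is not LLB. -/

import Mathlib

open MeasureTheory ProbabilityTheory Filter Topology Asymptotics
open scoped ENNReal NNReal

namespace InfiniteErgodic

section General

variable {X : Type*} [MeasurableSpace X]

/-! ### Return times, quasi finiteness, log lower boundedness -/

/-- The first return time `φ_A(x) = min {n ≥ 1 : T^n x ∈ A}`. For a conservative map it is a
genuine minimum at almost every `x ∈ A`; elsewhere the value is irrelevant. -/
noncomputable def returnTime (T : X → X) (A : Set X) (x : X) : ℕ :=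
  sInf {n : ℕ | 1 ≤ n ∧ T^[n] x ∈ A}

/-- The `n`-th cell (`n ≥ 1`) `A ∩ T⁻ⁿ A \ ⋃_{1 ≤ j < n} T⁻ʲ A` of the first return time
partition `ρ_A`. -/
def returnCell (T : X → X) (A : Set X) (n : ℕ) : Set X :=
  {x | x ∈ A ∧ T^[n] x ∈ A ∧ ∀ j, 1 ≤ j → j < n → T^[j] x ∉ A}

/-- The entropy `H_A(ρ_A) = ∑_{n ≥ 1} p_n log (1 / p_n)` of the first return time partition, where
`p_n = m(cell_n) / m(A)`. The summands are non-negative, and the sum is taken in `[0, ∞]`. -/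
noncomputable def returnEntropy (T : X → X) (m : Measure X) (A : Set X) : ℝ≥0∞ :=
  ∑' n : ℕ, ENNReal.ofReal (Real.negMulLog ((m[|A]).real (returnCell T A (n + 1))))

/-- `T` is quasi finite: some measurable set of positive finite measure has a first return time
partition of finite entropy. -/
def QuasiFinite (T : X → X) (m : Measure X) : Prop :=
  ∃ A : Set X, MeasurableSet A ∧ 0 < m A ∧ m A < ∞ ∧ returnEntropy T m A < ∞

/-- `T` is log lower bounded (LLB): some measurable set `A` of positive finite measure has
`∫_A log φ_A dm < ∞`. -/
def LogLowerBounded (T : X → X) (m : Measure X) : Prop :=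
  ∃ A : Set X, MeasurableSet A ∧ 0 < m A ∧ m A < ∞ ∧
    ∫⁻ x in A, ENNReal.ofReal (Real.log (returnTime T A x)) ∂m < ∞

/-! ### Transfer operator, pointwise dual ergodicity, return sequences -/

/-- The transfer operator: `T̂ f` is the density with respect to `m` of the signed measure
`A ↦ ∫_{T⁻¹ A} f dm`. -/
noncomputable def transfer (T : X → X) (m : Measure X) (f : X → ℝ) : X → ℝ :=
  SignedMeasure.rnDeriv ((m.withDensityᵥ f).map T) m

/-- `T` is pointwise dual ergodic with return sequence `(a n)_{n ≥ 1}`: for some non-negative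
integrable `f` with positive integral, `(1 / a n) ∑_{k < n} T̂ᵏ f → ∫ f dm` almost everywhere. -/
def IsReturnSequence (T : X → X) (m : Measure X) (a : ℕ → ℝ) : Prop :=
  (∀ n, 1 ≤ n → 0 < a n) ∧
  ∃ f : X → ℝ, Integrable f m ∧ 0 ≤ᵐ[m] f ∧ 0 < ∫ x, f x ∂m ∧
    ∀ᵐ x ∂m, Tendsto (fun n : ℕ => (1 / a n) * ∑ k ∈ Finset.range n, (transfer T m)^[k] f x)
      atTop (𝓝 (∫ x, f x ∂m))

/-! ### Factors and isomorphisms -/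

/-- `(Y, m', T')` is a factor of `(X, m, T)`. -/
def IsFactor {Y : Type*} [MeasurableSpace Y] (T : X → X) (m : Measure X)
    (T' : Y → Y) (m' : Measure Y) : Prop :=
  ∃ Φ : X → Y, MeasurePreserving Φ m m' ∧ ∀ᵐ x ∂m, Φ (T x) = T' (Φ x)

/-- `(X, m, T)` and `(Y, m', T')` are isomorphic modulo null sets. -/
def IsIsomorphic {Y : Type*} [MeasurableSpace Y] (T : X → X) (m : Measure X)
    (T' : Y → Y) (m' : Measure Y) : Prop :=
  ∃ (Φ : X → Y) (Ψ : Y → X), MeasurePreserving Φ m m' ∧ MeasurePreserving Ψ m' m ∧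
    (∀ᵐ x ∂m, Ψ (Φ x) = x) ∧ (∀ᵐ y ∂m', Φ (Ψ y) = y) ∧ ∀ᵐ x ∂m, Φ (T x) = T' (Φ x)

/-! ### Shifts and Markov shifts, one-sided (`I = ℕ`) and two-sided (`I = ℤ`) -/

/-- The left shift on sequences indexed by `I` (`I = ℕ` or `I = ℤ`). -/
def shift (I : Type*) [AddMonoidWithOne I] {S : Type*} (x : I → S) : I → S :=
  fun i => x (i + 1)

/-- `ν` is the shift invariant Markov measure on `S^I` of the stochastic matrix `p` and the
(possibly infinite) stationary distribution `q`. -/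
structure IsMarkovMeasure (I : Type*) [AddMonoidWithOne I] {S : Type*} [MeasurableSpace S]
    (p : S → S → ℝ≥0) (q : S → ℝ≥0) (ν : Measure (I → S)) : Prop where
  stochastic : ∀ s, HasSum (p s) 1
  stationary : ∀ t, HasSum (fun s => q s * p s t) (q t)
  cylinder : ∀ (k : I) (n : ℕ) (s : ℕ → S),
    ν {x | ∀ i : ℕ, i ≤ n → x (k + (i : I)) = s i} =
      ((q (s 0) * ∏ i ∈ Finset.range n, p (s i) (s (i + 1)) : ℝ≥0) : ℝ≥0∞)

/-- `(X, m, T)` is (isomorphic to) a Markov shift with a countable (discrete) state space,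
one-sided if `I = ℕ` and two-sided if `I = ℤ`. -/
def IsMarkovShift (I : Type*) [AddMonoidWithOne I] (T : X → X) (m : Measure X) : Prop :=
  ∃ (S : Type) (_ : Countable S) (_ : MeasurableSpace S) (_ : DiscreteMeasurableSpace S)
    (p : S → S → ℝ≥0) (q : S → ℝ≥0) (ν : Measure (I → S)),
    IsMarkovMeasure I p q ν ∧ IsIsomorphic T m (shift I) ν

end General

/-! ### Towers -/

section Tower

variable {Ω : Type*}

/-- The tower `{(ω, j) : 0 ≤ j < φ(ω)}` with height function `φ`. -/
abbrev Tower (φ : Ω → ℕ+) : Type _ := {x : Ω × ℕ // x.2 < (φ x.1 : ℕ)}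

/-- The tower map over `S`: `(ω, j) ↦ (ω, j + 1)` if `j + 1 < φ(ω)`, and `(ω, j) ↦ (S ω, 0)`
if `j + 1 = φ(ω)`. -/
def towerMap (S : Ω → Ω) (φ : Ω → ℕ+) (x : Tower φ) : Tower φ :=
  if h : x.1.2 + 1 < (φ x.1.1 : ℕ) then ⟨(x.1.1, x.1.2 + 1), h⟩
  else ⟨(S x.1.1, 0), (φ (S x.1.1)).pos⟩

/-- The tower measure: the restriction of `P × counting measure` to the tower. -/
noncomputable def towerMeasure [MeasurableSpace Ω] (P : Measure Ω) (φ : Ω → ℕ+) :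
    Measure (Tower φ) :=
  (P.prod Measure.count).comap Subtype.val

end Tower

/-! ### The tower over a Bernoulli shift with lacunary return distribution -/

instance : MeasurableSpace ℕ+ := ⊤

instance : DiscreteMeasurableSpace ℕ+ := ⟨fun _ => trivial⟩

/-- The lacunary probability distribution `f` on the positive integers, with
`f {4 ^ 4 ^ n} = 1 / 2 ^ n` for `n ≥ 1`. -/
noncomputable def lacunary : Measure ℕ+ :=
  Measure.sum fun n : ℕ => ((2 : ℝ≥0∞)⁻¹ ^ (n + 1)) • Measure.dirac ((4 : ℕ+) ^ 4 ^ (n + 1))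

instance : IsProbabilityMeasure lacunary := by
  constructor
  simp only [lacunary, Measure.sum_apply _ MeasurableSet.univ, Measure.smul_apply, measure_univ,
    smul_eq_mul, mul_one]
  rw [ENNReal.tsum_geometric_add_one, ENNReal.one_sub_inv_two, inv_inv]
  exact ENNReal.inv_mul_cancel (by norm_num) (by norm_num)

/-- The product measure `f^I` on sequences of positive integers. -/
noncomputable def bernoulliProduct (I : Type*) : Measure (I → ℕ+) :=
  Measure.infinitePi fun _ => lacunary

/-- The height function `ω ↦ ω 0`. -/
def height (I : Type*) [AddMonoidWithOne I] (ω : I → ℕ+) : ℕ+ := ω 0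

/-- The tower over the Bernoulli shift with height function `ω ↦ ω 0`. -/
abbrev lacTower (I : Type*) [AddMonoidWithOne I] : Type _ := Tower (height I)

/-- The tower map over the Bernoulli shift. -/
def lacMap (I : Type*) [AddMonoidWithOne I] : lacTower I → lacTower I :=
  towerMap (shift I) (height I)

/-- The invariant measure of the tower over the Bernoulli shift. -/
noncomputable def lacMeasure (I : Type*) [AddMonoidWithOne I] : Measure (lacTower I) :=
  towerMeasure (bernoulliProduct I) (height I)

end InfiniteErgodic

open InfiniteErgodic

/-!
The base of the tower is the set of points at level zero. The first return map to it is the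
Bernoulli shift and the first return time is the zeroth coordinate, so that the successive return
times are independent with the lacunary distribution `f`.

**General dynamics.** The tower map preserves the tower measure because the measure of a set is the
sum of the measures of its slices at the various levels (`towerMeasure_apply`). Conservativity and
ergodicity are inherited from the base (`conservative_towerMap`, `ergodic_towerMap`); the Bernoulli
shift is ergodic since square cylinders are eventually independent of their translates, and this
mixing property extends to all measurable sets (`ergodic_of_mixingPair`).

**Quasi finiteness.** For the base, the return time partition has cells of measure `2⁻ⁿ`, and
`∑ n 2⁻ⁿ log 2` converges (`quasiFinite_lacMap`).

**Failure of LLB.** If `log φ_A` is integrable on some `A`, then by the Borel–Cantelli lemma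
`log φ_A = o(k)` along the orbits of the induced map, so the time of the `k`-th return to `A` is
`exp (o(k))`. Hopf's maximal inequality, applied to `1_A - C 1_B`, bounds the time spent in `A` by a
multiple of the time spent in any other set `B` of positive finite measure
(`ae_exists_visits_le`). So almost every orbit that starts in `A` visits the base at least
logarithmically often, with an arbitrarily large constant
(`LogLowerBounded.frequently_le_exp_visits`). But `log` is not `f`-integrable, and the second
Borel–Cantelli lemma gives infinitely many `l` for which the `l`-th height exceeds `exp l`, a
contradiction (`not_logLowerBounded_lacMap`).

**Return sequence.** On the one-sided tower the iterates of the transfer operator on the indicator of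
the base depend only on the level: `T̂ᵏ 1` at level `j` is `u (k - j)` for `j ≤ k`, where `u` is the
renewal sequence of `f` (`transfer_iterate_levelDensity`). As `u ≤ 1` and `U n = ∑_{k < n} u k` tends
to infinity, `U` is a return sequence. Conservation of mass,
`∑_{j ≤ n} u (n - j) f {j + 1, j + 2, …} = 1`, yields both `U n · f {n, n + 1, …} ≤ 1` and
`n ≤ U n · ∑_{j ≤ n} f {j, j + 1, …}`. Since the tail of `f` is `2⁻ᵐ` between `4 ^ 4 ^ m` and
`4 ^ 4 ^ (m + 1)`, it follows that `U n` is comparable with `√(log n)` (`renewalSum_isTheta`).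

**Markov structure.** The pairs (current height, current level) form a Markov chain along an orbit,
and the sequence of these pairs determines the point: one reads off the heights whenever the level
returns to zero. The coding map is therefore an injective measurable map between standard Borel
spaces, hence an isomorphism onto its image (`isIsomorphic_shift_of_injective`).
-/

open InfiniteErgodic

namespace InfiniteErgodic

/-! ### Dynamics and measure of a tower -/

section Tower

variable {Ω : Type*} {φ : Ω → ℕ+} {S : Ω → Ω}

/-- The part of `A` at level `j` of a tower, as a subset of the base. -/
def slice (A : Set (Tower φ)) (j : ℕ) : Set Ω :=
  {ω | ∃ h : j < (φ ω : ℕ), (⟨(ω, j), h⟩ : Tower φ) ∈ A}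

/-- The point of the base of the tower above `ω`. -/
def basePt (φ : Ω → ℕ+) (ω : Ω) : Tower φ := ⟨(ω, 0), (φ ω).pos⟩

/-- The base (level zero) of a tower. -/
def towerBase (φ : Ω → ℕ+) : Set (Tower φ) := {x | x.1.2 = 0}

lemma towerMap_of_lt {x : Tower φ} (h : x.1.2 + 1 < (φ x.1.1 : ℕ)) :
    towerMap S φ x = ⟨(x.1.1, x.1.2 + 1), h⟩ := dif_pos h

lemma towerMap_of_not_lt {x : Tower φ} (h : ¬ x.1.2 + 1 < (φ x.1.1 : ℕ)) :
    towerMap S φ x = basePt φ (S x.1.1) := dif_neg h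

lemma towerMap_iterate_of_lt (x : Tower φ) (k : ℕ) (h : x.1.2 + k < (φ x.1.1 : ℕ)) :
    (towerMap S φ)^[k] x = ⟨(x.1.1, x.1.2 + k), h⟩ := by
  induction k with
  | zero => rfl
  | succ k ih =>
    rw [Function.iterate_succ_apply', ih (by lia), towerMap_of_lt (by simpa using by lia)]
    rfl

lemma towerMap_iterate_exit (x : Tower φ) :
    (towerMap S φ)^[(φ x.1.1 : ℕ) - x.1.2] x = basePt φ (S x.1.1) := by
  have hx := x.2
  obtain ⟨k, hk⟩ : ∃ k, (φ x.1.1 : ℕ) - x.1.2 = k + 1 := ⟨(φ x.1.1 : ℕ) - x.1.2 - 1, by lia⟩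
  rw [hk, Function.iterate_succ_apply', towerMap_iterate_of_lt x k (by lia)]
  exact towerMap_of_not_lt (by simpa using by lia)

lemma towerMap_iterate_birkhoffSum (ω : Ω) (n : ℕ) :
    (towerMap S φ)^[birkhoffSum S (fun ω => (φ ω : ℕ)) n ω] (basePt φ ω) = basePt φ (S^[n] ω) := by
  induction n with
  | zero => simp
  | succ n ih =>
    rw [birkhoffSum_succ, add_comm, Function.iterate_add_apply, ih, Function.iterate_succ_apply']
    exact towerMap_iterate_exit (basePt φ (S^[n] ω))

lemma slice_preimage (A : Set (Tower φ)) (j : ℕ) :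
    slice (towerMap S φ ⁻¹' A) j =
      slice A (j + 1) ∪ {ω | (φ ω : ℕ) = j + 1} ∩ S ⁻¹' slice A 0 := by
  ext ω
  simp only [slice, Set.mem_ofPred_eq, Set.mem_preimage, Set.mem_union, Set.mem_inter_iff]
  by_cases h : j + 1 < (φ ω : ℕ)
  · constructor
    · rintro ⟨h', hA⟩
      rw [towerMap_of_lt (by exact h)] at hA
      exact Or.inl ⟨h, hA⟩
    · rintro (⟨_, hA⟩ | ⟨h', _⟩)
      · refine ⟨by lia, ?_⟩
        rwa [towerMap_of_lt (by exact h)]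
      · lia
  · constructor
    · rintro ⟨h', hA⟩
      rw [towerMap_of_not_lt (by exact h)] at hA
      exact Or.inr ⟨by lia, (φ (S ω)).pos, hA⟩
    · rintro (⟨h', _⟩ | ⟨h', _, hA⟩)
      · lia
      · refine ⟨by lia, ?_⟩
        rwa [towerMap_of_not_lt (by exact h)]

lemma slice_inter_towerBase_zero (A : Set (Tower φ)) : slice (A ∩ towerBase φ) 0 = slice A 0 := by
  ext ω; simp [slice, towerBase]

lemma slice_inter_towerBase_succ (A : Set (Tower φ)) (j : ℕ) :
    slice (A ∩ towerBase φ) (j + 1) = ∅ := by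
  ext ω; simp [slice, towerBase]

variable [MeasurableSpace Ω]

lemma measurableSet_tower (hφ : Measurable φ) :
    MeasurableSet {x : Ω × ℕ | x.2 < (φ x.1 : ℕ)} :=
  measurableSet_lt measurable_snd ((Measurable.of_discrete (f := fun n : ℕ+ => (n : ℕ))).comp
    (hφ.comp measurable_fst))

lemma measurableEmbedding_tower_val (hφ : Measurable φ) :
    MeasurableEmbedding (Subtype.val : Tower φ → Ω × ℕ) :=
  MeasurableEmbedding.subtype_coe (measurableSet_tower hφ)

lemma measurableSet_slice (hφ : Measurable φ) {A : Set (Tower φ)} (hA : MeasurableSet A) (j : ℕ) :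
    MeasurableSet (slice A j) := by
  obtain ⟨B, hB, rfl⟩ := hA
  have : slice (Subtype.val ⁻¹' B : Set (Tower φ)) j =
      (fun ω => (ω, j)) ⁻¹' ({x : Ω × ℕ | x.2 < (φ x.1 : ℕ)} ∩ B) := by
    ext ω; simp [slice]
  rw [this]
  exact measurable_prodMk_right ((measurableSet_tower hφ).inter hB)

lemma towerMeasure_apply (P : Measure Ω) [SFinite P] (hφ : Measurable φ) {A : Set (Tower φ)}
    (hA : MeasurableSet A) : towerMeasure P φ A = ∑' j, P (slice A j) := by
  have hE := measurableEmbedding_tower_val hφ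
  rw [towerMeasure, hE.comap_apply, Measure.prod_apply_symm (hE.measurableSet_image.2 hA),
    lintegral_count]
  refine tsum_congr fun j => congrArg P ?_
  ext ω
  simp [slice]

lemma sigmaFinite_towerMeasure (P : Measure Ω) [SigmaFinite P] (hφ : Measurable φ) :
    SigmaFinite (towerMeasure P φ) := by
  have hE := measurableEmbedding_tower_val hφ
  have : SigmaFinite ((towerMeasure P φ).map Subtype.val) := by
    rw [towerMeasure, hE.map_comap]
    infer_instance
  exact SigmaFinite.of_map _ hE.measurable.aemeasurable this

lemma measurable_towerMap (hφ : Measurable φ) (hS : Measurable S) :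
    Measurable (towerMap S φ) := by
  have hE := measurableEmbedding_tower_val hφ
  rw [← hE.measurable_comp_iff]
  have : (Subtype.val ∘ towerMap S φ) = fun x : Tower φ =>
      if x.1.2 + 1 < (φ x.1.1 : ℕ) then (x.1.1, x.1.2 + 1) else (S x.1.1, 0) := by
    funext x
    by_cases h : x.1.2 + 1 < (φ x.1.1 : ℕ)
    · simp [towerMap_of_lt h, h]
    · simp [towerMap_of_not_lt h, h, basePt]
  rw [this]
  refine Measurable.ite ?_ (by fun_prop) (by fun_prop)
  exact measurableSet_lt (by fun_prop) ((Measurable.of_discrete (f := fun n : ℕ+ => (n : ℕ))).comp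
    (hφ.comp (by fun_prop)))

lemma measurableSet_towerBase (φ : Ω → ℕ+) : MeasurableSet (towerBase φ) :=
  (measurable_snd.comp measurable_subtype_coe) (measurableSet_singleton 0)

lemma towerMeasure_inter_towerBase (P : Measure Ω) [SFinite P] (hφ : Measurable φ)
    {A : Set (Tower φ)} (hA : MeasurableSet A) :
    towerMeasure P φ (A ∩ towerBase φ) = P (slice A 0) := by
  rw [towerMeasure_apply P hφ (hA.inter (measurableSet_towerBase φ)), tsum_eq_single 0,
    slice_inter_towerBase_zero]
  intro j hj
  obtain ⟨j, rfl⟩ := Nat.exists_eq_succ_of_ne_zero hj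
  rw [Nat.succ_eq_add_one, slice_inter_towerBase_succ, measure_empty]

lemma towerMeasure_towerBase (P : Measure Ω) [SFinite P] (hφ : Measurable φ) :
    towerMeasure P φ (towerBase φ) = P Set.univ := by
  rw [← Set.univ_inter (towerBase φ), towerMeasure_inter_towerBase P hφ MeasurableSet.univ]
  congr 1
  ext ω
  simp [slice]

lemma measure_slice_preimage (P : Measure Ω) (hφ : Measurable φ) (hS : Measurable S)
    {A : Set (Tower φ)} (hA : MeasurableSet A) (j : ℕ) :
    P (slice (towerMap S φ ⁻¹' A) j) =
      P (slice A (j + 1)) + P ({ω | (φ ω : ℕ) = j + 1} ∩ S ⁻¹' slice A 0) := by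
  rw [slice_preimage, measure_union _ (MeasurableSet.inter _ (hS (measurableSet_slice hφ hA 0)))]
  · refine Set.disjoint_left.2 fun ω h h' => ?_
    obtain ⟨h, -⟩ := h
    have : (φ ω : ℕ) = j + 1 := h'.1
    lia
  · exact ((Measurable.of_discrete (f := fun n : ℕ+ => (n : ℕ))).comp hφ)
      (measurableSet_singleton (j + 1))

lemma measurePreserving_towerMap {P : Measure Ω} [SFinite P] (hφ : Measurable φ)
    (hS : MeasurePreserving S P P) :
    MeasurePreserving (towerMap S φ) (towerMeasure P φ) (towerMeasure P φ) := by
  have hT := measurable_towerMap hφ hS.measurable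
  refine ⟨hT, Measure.ext fun A hA => ?_⟩
  have h0 := measurableSet_slice hφ hA 0
  rw [Measure.map_apply hT hA, towerMeasure_apply P hφ hA, towerMeasure_apply P hφ (hT hA),
    tsum_congr (measure_slice_preimage P hφ hS.measurable hA), ENNReal.tsum_add,
    tsum_eq_zero_add' (f := fun j => P (slice A j)) ENNReal.summable, add_comm]
  congr 1
  rw [← hS.measure_preimage h0.nullMeasurableSet, ← measure_iUnion]
  · congr 1
    ext ω
    simp only [Set.mem_iUnion, Set.mem_inter_iff, Set.mem_ofPred_eq, Set.mem_preimage,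
      exists_and_right, and_iff_right_iff_imp]
    exact fun _ => ⟨(φ ω : ℕ) - 1, by have := (φ ω).pos; lia⟩
  · intro i j hij
    refine Set.disjoint_left.2 fun ω h h' => hij ?_
    have h1 : (φ ω : ℕ) = i + 1 := h.1
    have h2 : (φ ω : ℕ) = j + 1 := h'.1
    lia
  · intro j
    exact (((Measurable.of_discrete (f := fun n : ℕ+ => (n : ℕ))).comp hφ)
      (measurableSet_singleton (j + 1))).inter (hS.measurable h0)

lemma conservative_towerMap {P : Measure Ω} [IsFiniteMeasure P] (hφ : Measurable φ)
    (hS : MeasurePreserving S P P) :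
    Conservative (towerMap S φ) (towerMeasure P φ) := by
  refine ⟨(measurePreserving_towerMap hφ hS).quasiMeasurePreserving, fun A hA h0 => ?_⟩
  rw [towerMeasure_apply P hφ hA, Ne, ENNReal.tsum_eq_zero, not_forall] at h0
  obtain ⟨j, hj⟩ := h0
  obtain ⟨ω, ⟨h1, hω⟩, n, hn, ⟨h2, hω'⟩⟩ :=
    hS.conservative.exists_mem_iterate_mem (measurableSet_slice hφ hA j).nullMeasurableSet hj
  refine ⟨_, hω, j + (birkhoffSum S (fun ω => (φ ω : ℕ)) (n - 1) (S ω) + (φ ω - j)), ?_, ?_⟩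
  · lia
  · obtain ⟨n, rfl⟩ := Nat.exists_eq_succ_of_ne_zero hn
    have hexit := towerMap_iterate_exit (S := S) (⟨(ω, j), h1⟩ : Tower φ)
    dsimp only at hexit
    rw [Function.iterate_add_apply, Function.iterate_add_apply, hexit]
    simp only [Nat.succ_eq_add_one, Nat.add_sub_cancel]
    rw [towerMap_iterate_birkhoffSum, ← Function.iterate_succ_apply,
      towerMap_iterate_of_lt _ _ (by simpa [basePt] using h2)]
    simpa [basePt] using hω'

lemma ergodic_towerMap {P : Measure Ω} [IsFiniteMeasure P] (hφ : Measurable φ)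
    (hS : Ergodic S P) : Ergodic (towerMap S φ) (towerMeasure P φ) := by
  refine ⟨measurePreserving_towerMap hφ hS.toMeasurePreserving, ⟨fun A hA hinv => ?_⟩⟩
  have hiter : ∀ n x, (towerMap S φ)^[n] x ∈ A ↔ x ∈ A := by
    intro n
    induction n with
    | zero => simp
    | succ n ih =>
      intro x
      rw [Function.iterate_succ_apply, ih, ← Set.mem_preimage, hinv]
  -- an invariant set contains with a base point the whole column above it
  have hlevel : ∀ j (ω : Ω), ω ∈ slice A j ↔ j < (φ ω : ℕ) ∧ ω ∈ slice A 0 := by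
    intro j ω
    refine ⟨fun ⟨h, hx⟩ => ⟨h, (φ ω).pos, ?_⟩, fun ⟨h, _, hx⟩ => ⟨h, ?_⟩⟩
    · rw [← hiter j, towerMap_iterate_of_lt _ _ (by simpa using h)]
      simpa using hx
    · rw [← hiter j, towerMap_iterate_of_lt _ _ (by simpa using h)] at hx
      simpa using hx
  have hS0 : S ⁻¹' slice A 0 = slice A 0 := by
    ext ω
    have h := hiter (φ ω) (basePt φ ω)
    have hexit := towerMap_iterate_exit (S := S) (basePt φ ω)
    simp only [basePt, Nat.sub_zero] at hexit h
    rw [hexit] at h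
    exact ⟨fun ⟨_, hx⟩ => ⟨(φ ω).pos, h.1 hx⟩, fun ⟨_, hx⟩ => ⟨(φ (S ω)).pos, h.2 hx⟩⟩
  rw [eventuallyConst_set']
  rcases hS.toPreErgodic.measure_self_or_compl_eq_zero (measurableSet_slice hφ hA 0) hS0 with h | h
  · refine Or.inl ?_
    rw [ae_eq_empty, towerMeasure_apply P hφ hA, ENNReal.tsum_eq_zero]
    exact fun j => measure_mono_null (fun ω hω => ((hlevel j ω).1 hω).2) h
  · refine Or.inr ?_
    rw [ae_eq_univ, towerMeasure_apply P hφ hA.compl, ENNReal.tsum_eq_zero]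
    refine fun j => measure_mono_null (t := (slice A 0)ᶜ) (fun ω hω hω' => ?_) h
    obtain ⟨h1, h2⟩ := hω
    obtain ⟨_, h3⟩ := (hlevel j ω).2 ⟨h1, hω'⟩
    exact h2 h3

end Tower

/-! ### Mixing and ergodicity of the Bernoulli shift -/

section Mixing

variable {Ω : Type*} [MeasurableSpace Ω] {P : Measure Ω} [IsProbabilityMeasure P] {T : Ω → Ω}

/-- The correlations of `A` with the preimages `T⁻ⁿ B` converge to the product of the measures. -/
def MixingPair (P : Measure Ω) (T : Ω → Ω) (A B : Set Ω) : Prop :=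
  Tendsto (fun n : ℕ => P.real (A ∩ T^[n] ⁻¹' B)) atTop (𝓝 (P.real A * P.real B))

lemma hasSum_measureReal_iUnion {f : ℕ → Set Ω} (hd : Pairwise (Function.onFun Disjoint f))
    (hm : ∀ i, MeasurableSet (f i)) : HasSum (fun i => P.real (f i)) (P.real (⋃ i, f i)) := by
  have hsum : ∑' i, P (f i) = P (⋃ i, f i) := (measure_iUnion hd hm).symm
  have := (ENNReal.hasSum_toReal (f := fun i => P (f i)) (by rw [hsum]; exact measure_ne_top _ _))
  rwa [← ENNReal.tsum_toReal_eq (fun _ => measure_ne_top _ _), hsum] at this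

lemma MixingPair.compl_left (hT : MeasurePreserving T P P) {A B : Set Ω} (hA : MeasurableSet A)
    (hB : MeasurableSet B) (h : MixingPair P T A B) : MixingPair P T Aᶜ B := by
  have key : ∀ n : ℕ, P.real (Aᶜ ∩ T^[n] ⁻¹' B) = P.real B - P.real (A ∩ T^[n] ⁻¹' B) := by
    intro n
    have h1 := measureReal_inter_add_sdiff (μ := P) (s := T^[n] ⁻¹' B) hA
    have h2 : P.real (T^[n] ⁻¹' B) = P.real B :=
      (hT.iterate n).measureReal_preimage hB.nullMeasurableSet
    rw [Set.inter_comm, ← Set.sdiff_eq, Set.inter_comm A]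
    linarith
  simp only [MixingPair, key, probReal_compl_eq_one_sub hA, sub_mul, one_mul]
  exact tendsto_const_nhds.sub h

lemma MixingPair.compl_right (hT : MeasurePreserving T P P) {A B : Set Ω}
    (hB : MeasurableSet B) (h : MixingPair P T A B) : MixingPair P T A Bᶜ := by
  have key : ∀ n : ℕ, P.real (A ∩ T^[n] ⁻¹' Bᶜ) = P.real A - P.real (A ∩ T^[n] ⁻¹' B) := by
    intro n
    have h1 := measureReal_inter_add_sdiff (μ := P) (s := A) ((hT.iterate n).measurable hB)
    rw [Set.preimage_compl, ← Set.sdiff_eq]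
    linarith
  simp only [MixingPair, key, probReal_compl_eq_one_sub hB, mul_sub, mul_one]
  exact tendsto_const_nhds.sub h

lemma MixingPair.iUnion_left (hT : MeasurePreserving T P P) {f : ℕ → Set Ω} {B : Set Ω}
    (hd : Pairwise (Function.onFun Disjoint f)) (hf : ∀ i, MeasurableSet (f i))
    (hB : MeasurableSet B) (h : ∀ i, MixingPair P T (f i) B) :
    MixingPair P T (⋃ i, f i) B := by
  have hsum := hasSum_measureReal_iUnion (P := P) hd hf
  have key : ∀ n : ℕ, P.real ((⋃ i, f i) ∩ T^[n] ⁻¹' B) =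
      ∑' i, P.real (f i ∩ T^[n] ⁻¹' B) := by
    intro n
    rw [Set.iUnion_inter]
    exact (hasSum_measureReal_iUnion
      (fun i j hij => (hd hij).mono Set.inter_subset_left Set.inter_subset_left)
      (fun i => (hf i).inter ((hT.iterate n).measurable hB))).tsum_eq.symm
  simp only [MixingPair, key, ← hsum.tsum_eq, ← tsum_mul_right]
  refine tendsto_tsum_of_dominated_convergence hsum.summable h (Eventually.of_forall fun n i => ?_)
  rw [Real.norm_of_nonneg measureReal_nonneg]
  exact measureReal_mono Set.inter_subset_left

lemma MixingPair.iUnion_right (hT : MeasurePreserving T P P) {A : Set Ω} {f : ℕ → Set Ω}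
    (hd : Pairwise (Function.onFun Disjoint f)) (hf : ∀ i, MeasurableSet (f i))
    (hA : MeasurableSet A) (h : ∀ i, MixingPair P T A (f i)) :
    MixingPair P T A (⋃ i, f i) := by
  have hsum := hasSum_measureReal_iUnion (P := P) hd hf
  have key : ∀ n : ℕ, P.real (A ∩ T^[n] ⁻¹' (⋃ i, f i)) =
      ∑' i, P.real (A ∩ T^[n] ⁻¹' f i) := by
    intro n
    rw [Set.preimage_iUnion, Set.inter_iUnion]
    exact (hasSum_measureReal_iUnion
      (fun i j hij => ((hd hij).preimage _).mono Set.inter_subset_right Set.inter_subset_right)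
      (fun i => hA.inter ((hT.iterate n).measurable (hf i)))).tsum_eq.symm
  simp only [MixingPair, key, ← hsum.tsum_eq, ← tsum_mul_left]
  refine tendsto_tsum_of_dominated_convergence hsum.summable h (Eventually.of_forall fun n i => ?_)
  rw [Real.norm_of_nonneg measureReal_nonneg,
    ← (hT.iterate n).measureReal_preimage (hf i).nullMeasurableSet]
  exact measureReal_mono Set.inter_subset_right

/-- A measure preserving map that mixes the pairs of members of a generating `π`-system is ergodic:
mixing extends to all pairs of measurable sets, and an invariant set mixes with itself only if its
measure is zero or one. -/
lemma ergodic_of_mixingPair (hT : MeasurePreserving T P P) {C : Set (Set Ω)}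
    (hgen : ‹MeasurableSpace Ω› = MeasurableSpace.generateFrom C) (hpi : IsPiSystem C)
    (hC : ∀ A ∈ C, ∀ B ∈ C, MixingPair P T A B) : Ergodic T P := by
  have hmeas : ∀ A ∈ C, MeasurableSet A := fun A hA => by
    rw [hgen]; exact MeasurableSpace.measurableSet_generateFrom hA
  have h1 : ∀ A ∈ C, ∀ B, MeasurableSet B → MixingPair P T A B := fun A hA B hB =>
    MeasurableSpace.induction_on_inter (C := fun B _ => MixingPair P T A B) hgen hpi
      (by simp [MixingPair]) (fun B hB => hC A hA B hB)
      (fun B hB h => h.compl_right hT hB)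
      (fun f hd hf h => MixingPair.iUnion_right hT hd hf (hmeas A hA) h) B hB
  have h2 : ∀ A, MeasurableSet A → ∀ B, MeasurableSet B → MixingPair P T A B := fun A hA B hB =>
    MeasurableSpace.induction_on_inter (C := fun A _ => MixingPair P T A B) hgen hpi
      (by simp [MixingPair]) (fun A hA => h1 A hA B hB)
      (fun A hA h => h.compl_left hT hA hB)
      (fun f hd hf h => MixingPair.iUnion_left hT hd hf hB h) A hA
  refine ⟨hT, ⟨fun E hE hinv => ?_⟩⟩
  have hE2 : P.real E = P.real E * P.real E := by
    refine tendsto_nhds_unique ?_ (h2 E hE E hE)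
    have : ∀ n : ℕ, T^[n] ⁻¹' E = E := fun n => by
      induction n with
      | zero => rfl
      | succ n ih => rw [Function.iterate_succ, Set.preimage_comp, ih, hinv]
    simp [this]
  rw [eventuallyConst_set']
  have : P.real E = 0 ∨ P.real E = 1 := by
    rcases eq_or_ne (P.real E) 0 with h | h
    · exact Or.inl h
    · exact Or.inr (mul_right_cancel₀ h (by rw [one_mul]; exact hE2.symm))
  refine this.imp (fun h => ?_) (fun h => ?_)
  · rw [ae_eq_empty]; exact (measureReal_eq_zero_iff).1 h
  · rw [ae_eq_univ]
    refine (measureReal_eq_zero_iff).1 ?_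
    rw [probReal_compl_eq_one_sub hE, h, sub_self]

end Mixing

section Bernoulli

lemma measurePreserving_reindex {I J : Type*} {e : J → I} (he : Function.Injective e) :
    MeasurePreserving (fun (ω : I → ℕ+) j => ω (e j)) (bernoulliProduct I) (bernoulliProduct J) :=
  ⟨by fun_prop, Measure.map_infinitePi_infinitePi_of_inj (P := fun _ : I => lacunary) he⟩

instance (I : Type*) : IsProbabilityMeasure (bernoulliProduct I) :=
  inferInstanceAs (IsProbabilityMeasure (Measure.infinitePi fun _ : I => lacunary))

variable {I : Type*} [AddMonoidWithOne I]

lemma shift_iterate_apply {S : Type*} (n : ℕ) (x : I → S) (i : I) :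
    (shift I)^[n] x i = x (i + n) := by
  induction n generalizing x with
  | zero => simp
  | succ n ih =>
    rw [Function.iterate_succ_apply, ih, shift, Nat.cast_succ, add_assoc]

lemma measurable_height : Measurable (height I) := measurable_pi_apply 0

variable [IsCancelAdd I]

lemma measurePreserving_shift :
    MeasurePreserving (shift I) (bernoulliProduct I) (bernoulliProduct I) :=
  measurePreserving_reindex (add_left_injective 1)

variable [CharZero I]

/-- Square cylinders over disjoint sets of coordinates are independent, and the shift eventually
moves any finite set of coordinates off any other one. -/
lemma mixingPair_squareCylinder (s s' : Finset I) (t t' : I → Set ℕ+) :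
    MixingPair (bernoulliProduct I) (shift I) (Set.pi s t) (Set.pi s' t') := by
  classical
  refine tendsto_const_nhds.congr' ?_
  have hdisj : ∀ᶠ n : ℕ in atTop, ∀ i ∈ s, ∀ j ∈ s', i ≠ j + n := by
    simp only [Filter.eventually_all_finset]
    intro i _ j _
    rw [← Nat.cofinite_eq_atTop]
    refine Set.Subsingleton.finite fun a ha b hb => ?_
    simp only [Set.mem_compl_iff, Set.mem_ofPred_eq, not_not] at ha hb
    exact Nat.cast_injective (add_left_cancel (ha.symm.trans hb))
  filter_upwards [hdisj] with n hn
  have hinj : Function.Injective fun j : I => j + (n : I) := add_left_injective _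
  set u : I → Set ℕ+ := fun k =>
    if k ∈ s then t k else {y | ∀ j, j + (n : I) = k → y ∈ t' j} with hu
  have hset : (Set.pi s t) ∩ (shift I)^[n] ⁻¹' (Set.pi s' t') =
      Set.pi (s ∪ s'.image fun j => j + (n : I) : Finset I) u := by
    ext ω
    simp only [Set.mem_inter_iff, Set.mem_pi, Finset.mem_coe, Set.mem_preimage,
      shift_iterate_apply, Finset.mem_union, Finset.mem_image]
    constructor
    · rintro ⟨h1, h2⟩ k (hk | ⟨j, hj, rfl⟩)
      · simpa [hu, hk] using h1 k hk
      · have : j + (n : I) ∉ s := fun h => hn _ h j hj rfl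
        simp only [hu, this, if_false, Set.mem_ofPred_eq]
        intro j' hj'
        rw [hinj hj']
        exact h2 j hj
    · intro h
      refine ⟨fun k hk => by simpa [hu, hk] using h k (Or.inl hk), fun j hj => ?_⟩
      have : j + (n : I) ∉ s := fun h => hn _ h j hj rfl
      have h3 := h (j + n) (Or.inr ⟨j, hj, rfl⟩)
      simp only [hu, this, if_false, Set.mem_ofPred_eq] at h3
      exact h3 j rfl
  have hd : Disjoint s (s'.image fun j => j + (n : I)) := by
    rw [Finset.disjoint_left]
    intro k hk hk'
    obtain ⟨j, hj, rfl⟩ := Finset.mem_image.1 hk'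
    exact hn _ hk j hj rfl
  have e1 : ∏ k ∈ s, lacunary (u k) = ∏ k ∈ s, lacunary (t k) :=
    Finset.prod_congr rfl fun k hk => by simp [hu, hk]
  have e2 : ∏ k ∈ s', lacunary (u (k + n)) = ∏ k ∈ s', lacunary (t' k) :=
    Finset.prod_congr rfl fun k hk => by
      have : k + (n : I) ∉ s := fun h => hn _ h k hk rfl
      congr 1
      ext y
      simp only [hu, this, if_false, Set.mem_ofPred_eq]
      exact ⟨fun h => h k rfl, fun h j hj => by rwa [hinj hj]⟩
  rw [hset, measureReal_def, measureReal_def, measureReal_def, ← ENNReal.toReal_mul,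
    bernoulliProduct, Measure.infinitePi_pi _ fun _ _ => .of_discrete,
    Measure.infinitePi_pi _ fun _ _ => .of_discrete,
    Measure.infinitePi_pi _ fun _ _ => .of_discrete, Finset.prod_union hd,
    Finset.prod_image fun _ _ _ _ h => hinj h, e1, e2]

lemma ergodic_shift : Ergodic (shift I) (bernoulliProduct I) := by
  refine ergodic_of_mixingPair measurePreserving_shift
    (generateFrom_squareCylinders (α := fun _ : I => ℕ+)).symm
    (isPiSystem_squareCylinders (fun _ => MeasurableSpace.isPiSystem_measurableSet) (by simp)) ?_
  rintro _ ⟨s, t, -, rfl⟩ _ ⟨s', t', -, rfl⟩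
  exact mixingPair_squareCylinder s s' t t'

end Bernoulli

/-! ### The maximal inequality and comparison of occupation times -/

section Maximal

variable {X : Type*} {T : X → X}

/-- The maximum of the Birkhoff sums of `f` of length at most `N`, the empty sum included,
defined recursively. -/
noncomputable def maxSum (T : X → X) (f : X → ℝ) : ℕ → X → ℝ
  | 0, _ => 0
  | N + 1, x => max 0 (f x + maxSum T f N (T x))

lemma maxSum_nonneg (T : X → X) (f : X → ℝ) (N : ℕ) (x : X) : 0 ≤ maxSum T f N x := by
  cases N with
  | zero => exact le_rfl
  | succ N => exact le_max_left _ _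

lemma maxSum_le_succ (T : X → X) (f : X → ℝ) (N : ℕ) (x : X) :
    maxSum T f N x ≤ maxSum T f (N + 1) x := by
  induction N generalizing x with
  | zero => exact maxSum_nonneg T f 1 x
  | succ N ih => exact max_le_max le_rfl (by simpa using ih (T x))

lemma birkhoffSum_le_maxSum (T : X → X) (f : X → ℝ) (N : ℕ) (x : X) :
    birkhoffSum T f N x ≤ maxSum T f N x := by
  induction N generalizing x with
  | zero => simp [maxSum]
  | succ N ih =>
    rw [birkhoffSum_succ']
    exact le_max_of_le_right (by simpa using ih (T x))

/-- The number of visits of `x, T x, …, T^(N-1) x` to `A`. -/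
noncomputable def visits (T : X → X) (A : Set X) (N : ℕ) (x : X) : ℕ :=
  birkhoffSum T (A.indicator 1) N x

lemma visits_succ (T : X → X) (A : Set X) (N : ℕ) (x : X) :
    visits T A (N + 1) x = A.indicator 1 x + visits T A N (T x) := birkhoffSum_succ' ..

lemma visits_mono (T : X → X) (A : Set X) (x : X) : Monotone fun N => visits T A N x :=
  monotone_nat_of_le_succ fun N => by
    simp only [visits, birkhoffSum_succ]; exact Nat.le_add_right _ _

lemma indicator_one_le (A : Set X) (x : X) : A.indicator (1 : X → ℕ) x ≤ 1 :=
  Set.indicator_le_self' (by simp) x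

lemma cast_visits (T : X → X) (A : Set X) (N : ℕ) (x : X) :
    (visits T A N x : ℝ) = birkhoffSum T (A.indicator fun _ => (1 : ℝ)) N x := by
  simp only [visits, birkhoffSum, Nat.cast_sum]
  refine Finset.sum_congr rfl fun k _ => ?_
  by_cases h : T^[k] x ∈ A <;> simp [h]

variable [MeasurableSpace X] {m : Measure X}

lemma integrable_maxSum (hT : MeasurePreserving T m m) {f : X → ℝ} (hf : Integrable f m) (N : ℕ) :
    Integrable (maxSum T f N) m := by
  induction N with
  | zero => exact integrable_zero X ℝ m
  | succ N ih =>
    exact (integrable_zero X ℝ m).sup (hf.add (hT.integrable_comp_of_integrable ih))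

lemma measurable_maxSum (hT : Measurable T) {f : X → ℝ} (hf : Measurable f) (N : ℕ) :
    Measurable (maxSum T f N) := by
  induction N with
  | zero => exact measurable_const
  | succ N ih => exact measurable_const.max (hf.add (ih.comp hT))

/-- Hopf's maximal inequality, for a possibly infinite invariant measure. -/
lemma setIntegral_maxSum_pos_nonneg (hT : MeasurePreserving T m m) {f : X → ℝ}
    (hfm : Measurable f) (hf : Integrable f m) :
    0 ≤ ∫ x in ⋃ N, {x | 0 < maxSum T f N x}, f x ∂m := by
  have hmeas : ∀ N, MeasurableSet {x | 0 < maxSum T f N x} := fun N =>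
    measurableSet_lt measurable_const (measurable_maxSum hT.measurable hfm N)
  have hmono : Monotone fun N => {x | 0 < maxSum T f N x} :=
    monotone_nat_of_le_succ fun N x hx => lt_of_lt_of_le hx (maxSum_le_succ T f N x)
  refine ge_of_tendsto (tendsto_setIntegral_of_monotone hmeas hmono hf.integrableOn)
    (Eventually.of_forall fun N => ?_)
  have hint := integrable_maxSum hT hf N
  have hcomp : ∫ x, maxSum T f N (T x) ∂m = ∫ x, maxSum T f N x ∂m := by
    have := integral_map hT.measurable.aemeasurable
      (f := maxSum T f N) (by rw [hT.map_eq]; exact hint.aestronglyMeasurable)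
    rw [hT.map_eq] at this
    exact this.symm
  have h0 : ∫ x, (maxSum T f N x - maxSum T f N (T x)) ∂m = 0 := by
    have := integral_sub hint (hT.integrable_comp_of_integrable hint)
    simp only [Function.comp_apply] at this
    rw [this, hcomp, sub_self]
  rw [← integral_indicator (hmeas N)]
  refine h0.symm.le.trans ?_
  refine integral_mono (hint.sub (hT.integrable_comp_of_integrable hint))
    (hf.indicator (hmeas N)) fun x => ?_
  by_cases hx : 0 < maxSum T f N x
  · rw [Set.indicator_of_mem (by exact hx)]
    cases N with
    | zero => exact absurd hx (lt_irrefl _)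
    | succ N =>
      -- where the maximum is positive it is attained by a nonempty sum
      have h1 : maxSum T f (N + 1) x = f x + maxSum T f N (T x) := by
        rw [maxSum, max_eq_right_iff]
        by_contra! h
        rw [maxSum, max_eq_left h.le] at hx
        exact lt_irrefl _ hx
      have := maxSum_le_succ T f N (T x)
      simp only [h1]
      linarith
  · rw [Set.indicator_of_notMem (by exact hx)]
    have := maxSum_nonneg T f N (T x)
    simp only
    linarith

lemma measurable_visits (hT : Measurable T) {A : Set X} (hA : MeasurableSet A) (N : ℕ) :
    Measurable (visits T A N) := by
  unfold visits birkhoffSum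
  exact Finset.measurable_sum _ fun k _ => (measurable_one.indicator hA).comp (hT.iterate k)

/-- Along almost every orbit of an ergodic map the time spent in `A` is at most a constant multiple
of the time spent in `B`. The maximal inequality for `1_A - C 1_B` gives this on a set of positive
measure, and the set of all such points is invariant. -/
lemma ae_exists_visits_le (hT : Ergodic T m) {A B : Set X} (hA : MeasurableSet A)
    (hB : MeasurableSet B) (hA' : m A < ∞) (hB0 : 0 < m B) (hB' : m B < ∞) :
    ∀ᵐ x ∂m, ∃ C : ℕ, ∀ N, visits T A N x ≤ C * (visits T B N x + 1) := by
  set G : Set X := {x | ∃ C : ℕ, ∀ N, visits T A N x ≤ C * (visits T B N x + 1)} with hG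
  have hGm : MeasurableSet G := by
    have : G = ⋃ C : ℕ, ⋂ N, {x | visits T A N x ≤ C * (visits T B N x + 1)} := by
      ext x; simp [hG]
    rw [this]
    refine .iUnion fun C => .iInter fun N => measurableSet_le (measurable_visits hT.measurable hA N)
      (((measurable_visits hT.measurable hB N).add_const 1).const_mul C)
  -- moving along the orbit by one step changes each count by at most one
  have hinv : T ⁻¹' G = G := by
    ext x
    constructor
    · rintro ⟨C, hC⟩
      refine ⟨C + 1, fun N => ?_⟩
      cases N with
      | zero => simp [visits]
      | succ N =>
        rw [visits_succ, visits_succ]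
        have := hC N
        have := indicator_one_le A x
        nlinarith
    · rintro ⟨C, hC⟩
      refine ⟨2 * C, fun N => ?_⟩
      have h := hC (N + 1)
      rw [visits_succ, visits_succ] at h
      have := indicator_one_le B x
      nlinarith
  rcases hT.ae_mem_or_ae_notMem hGm hinv with h | h
  · exact h
  exfalso
  obtain ⟨C, hC⟩ := exists_nat_gt (m.real A / m.real B)
  have hBpos : 0 < m.real B := ENNReal.toReal_pos hB0.ne' hB'.ne
  rw [div_lt_iff₀ hBpos] at hC
  set f : X → ℝ := fun x => A.indicator (fun _ => 1) x - C * B.indicator (fun _ => 1) x with hf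
  have hAi : Integrable (A.indicator fun _ => (1 : ℝ)) m :=
    (integrable_indicator_iff hA).2 (integrableOn_const hA'.ne)
  have hBi : Integrable (B.indicator fun _ => (1 : ℝ)) m :=
    (integrable_indicator_iff hB).2 (integrableOn_const hB'.ne)
  have hfm : Measurable f := (measurable_const.indicator hA).sub
    ((measurable_const.indicator hB).const_mul _)
  have hfi : Integrable f m := hAi.sub (hBi.const_mul _)
  have hmax := setIntegral_maxSum_pos_nonneg hT.toMeasurePreserving hfm hfi
  -- outside `G` some Birkhoff sum of `f` is positive
  have hfull : (⋃ N, {x | 0 < maxSum T f N x}) =ᵐ[m] Set.univ := by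
    rw [ae_eq_univ]
    refine measure_mono_null (t := G) (fun x hx => ?_) (by simpa [ae_iff] using h)
    refine ⟨C, fun N => ?_⟩
    simp only [Set.mem_compl_iff, Set.mem_iUnion, Set.mem_ofPred_eq, not_exists, not_lt] at hx
    have h1 := (birkhoffSum_le_maxSum T f N x).trans (hx N)
    have h2 : birkhoffSum T f N x = visits T A N x - C * visits T B N x := by
      rw [cast_visits, cast_visits]
      simp [birkhoffSum, hf, Finset.sum_sub_distrib, Finset.mul_sum]
    rw [h2] at h1
    have h3 : (visits T A N x : ℝ) ≤ C * visits T B N x := by linarith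
    have h4 : visits T A N x ≤ C * visits T B N x := by exact_mod_cast h3
    nlinarith
  rw [setIntegral_congr_set hfull, setIntegral_univ, hf, integral_sub hAi (hBi.const_mul _),
    integral_const_mul, integral_indicator hA, integral_indicator hB] at hmax
  simp at hmax
  linarith

end Maximal

/-! ### Return times and the induced map -/

section Induced

variable {X : Type*} {T : X → X} {A : Set X}

/-- The induced map `x ↦ T^(φ_A x) x`. A point that never enters `A` is fixed by it, since its
return time is the infimum of the empty set. -/
noncomputable def inducedMap (T : X → X) (A : Set X) (x : X) : X := T^[returnTime T A x] x

lemma returnTime_spec {x : X} (h : ∃ n, 1 ≤ n ∧ T^[n] x ∈ A) :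
    1 ≤ returnTime T A x ∧ T^[returnTime T A x] x ∈ A := Nat.sInf_mem h

lemma notMem_of_lt_returnTime {x : X} {j : ℕ} (h1 : 1 ≤ j) (h2 : j < returnTime T A x) :
    T^[j] x ∉ A := fun h => Nat.notMem_of_lt_sInf h2 ⟨h1, h⟩

lemma returnTime_eq_zero {x : X} (h : ¬ ∃ n, 1 ≤ n ∧ T^[n] x ∈ A) : returnTime T A x = 0 :=
  Nat.sInf_eq_zero.2 (Or.inr (Set.eq_empty_iff_forall_notMem.2 fun n hn => h ⟨n, hn⟩))

lemma mapsTo_inducedMap : Set.MapsTo (inducedMap T A) A A := by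
  intro x hx
  by_cases h : ∃ n, 1 ≤ n ∧ T^[n] x ∈ A
  · exact (returnTime_spec h).2
  · rwa [inducedMap, returnTime_eq_zero h]

lemma iterate_birkhoffSum_returnTime (x : X) (n : ℕ) :
    T^[birkhoffSum (inducedMap T A) (returnTime T A) n x] x = (inducedMap T A)^[n] x := by
  induction n with
  | zero => rfl
  | succ n ih =>
    rw [birkhoffSum_succ, add_comm, Function.iterate_add_apply, ih, Function.iterate_succ_apply']
    rfl

/-- The Birkhoff sum of the return time over the induced map is the time of the `n`-th return. -/
lemma lt_visits_of_birkhoffSum_returnTime_lt {x : X} (hx : x ∈ A)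
    (hret : ∀ n, ∃ k, n < k ∧ T^[k] x ∈ A) {n N : ℕ}
    (hN : birkhoffSum (inducedMap T A) (returnTime T A) n x < N) : n < visits T A N x := by
  have hmem : ∀ n, T^[birkhoffSum (inducedMap T A) (returnTime T A) n x] x ∈ A := fun n => by
    rw [iterate_birkhoffSum_returnTime]; exact mapsTo_inducedMap.iterate n hx
  induction n generalizing N with
  | zero =>
    refine lt_of_lt_of_le ?_ (visits_mono T A x (Nat.succ_le_of_lt hN))
    simp [visits, hx]
  | succ n ih =>
    set τ := birkhoffSum (inducedMap T A) (returnTime T A) with hτ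
    have hpos : 1 ≤ returnTime T A ((inducedMap T A)^[n] x) := by
      obtain ⟨k, hk, hk'⟩ := hret (τ n x)
      refine (returnTime_spec ⟨k - τ n x, by lia, ?_⟩).1
      rw [← iterate_birkhoffSum_returnTime, ← Function.iterate_add_apply, ← hτ,
        Nat.sub_add_cancel hk.le]
      exact hk'
    have hlt : τ n x < τ (n + 1) x := by
      rw [hτ, birkhoffSum_succ]; lia
    have h1 := ih hlt
    refine lt_of_lt_of_le ?_ (visits_mono T A x (Nat.succ_le_of_lt hN))
    have h2 : visits T A (τ (n + 1) x + 1) x = visits T A (τ (n + 1) x) x + 1 := by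
      simp only [visits]
      rw [birkhoffSum_succ, Set.indicator_of_mem (hmem (n + 1))]
      rfl
    simp only [Nat.succ_eq_add_one, h2]
    lia

lemma birkhoffSum_returnTime_le {x : X} {K : ℕ} (hK : 0 < K)
    (h : ∀ᶠ k : ℕ in atTop, K * Real.log (returnTime T A ((inducedMap T A)^[k] x)) ≤ k) :
    ∃ C : ℝ, 0 ≤ C ∧ ∀ n : ℕ, ((birkhoffSum (inducedMap T A) (returnTime T A) n x : ℕ) : ℝ) ≤
      C + n * Real.exp (n / K) := by
  obtain ⟨k₀, hk₀⟩ := eventually_atTop.1 h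
  set τ := birkhoffSum (inducedMap T A) (returnTime T A) with hτ
  refine ⟨τ k₀ x, Nat.cast_nonneg _, fun n => ?_⟩
  have hbound : ∀ n, (τ n x : ℝ) ≤ τ k₀ x + ∑ k ∈ Finset.range n, Real.exp (k / K) := by
    intro n
    rcases le_total n k₀ with hn | hn
    · have h1 : τ n x ≤ τ k₀ x := by
        simp only [hτ, birkhoffSum]
        exact Finset.sum_le_sum_of_subset (Finset.range_mono hn)
      have h2 : (0 : ℝ) ≤ ∑ k ∈ Finset.range n, Real.exp (k / K) :=
        Finset.sum_nonneg fun _ _ => (Real.exp_pos _).le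
      have h3 : (τ n x : ℝ) ≤ τ k₀ x := by exact_mod_cast h1
      linarith
    · induction n, hn using Nat.le_induction with
      | base => simp [Finset.sum_nonneg fun _ _ => (Real.exp_pos _).le]
      | succ n hn ih =>
        rw [hτ, birkhoffSum_succ, ← hτ, Finset.sum_range_succ, Nat.cast_add]
        have h1 : (returnTime T A ((inducedMap T A)^[n] x) : ℝ) ≤ Real.exp (n / K) := by
          rcases Nat.eq_zero_or_pos (returnTime T A ((inducedMap T A)^[n] x)) with h0 | h0
          · rw [h0]; simpa using (Real.exp_pos _).le
          · rw [← Real.log_le_iff_le_exp (by exact_mod_cast h0), le_div_iff₀' (by exact_mod_cast hK)]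
            exact hk₀ n hn
        linarith
  refine (hbound n).trans (add_le_add le_rfl ?_)
  calc ∑ k ∈ Finset.range n, Real.exp (k / K) ≤ ∑ k ∈ Finset.range n, Real.exp (n / K) := by
        refine Finset.sum_le_sum fun k hk => Real.exp_le_exp.2 ?_
        have : (k : ℝ) ≤ n := by exact_mod_cast (Finset.mem_range.1 hk).le
        gcongr
    _ = n * Real.exp (n / K) := by simp

variable [MeasurableSpace X] {m : Measure X}

lemma measurable_returnTime (hT : Measurable T) (hA : MeasurableSet A) :
    Measurable (returnTime T A) := by
  refine measurable_of_Iio fun n => ?_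
  have : returnTime T A ⁻¹' Set.Iio n =
      (⋃ k ∈ Set.Ico 1 n, T^[k] ⁻¹' A) ∪ ({_x | 0 < n} ∩ ⋂ k ∈ Set.Ici 1, T^[k] ⁻¹' Aᶜ) := by
    ext x
    simp only [Set.mem_preimage, Set.mem_Iio, Set.mem_union, Set.mem_iUnion, Set.mem_Ico,
      exists_prop, Set.mem_inter_iff, Set.mem_ofPred_eq, Set.mem_iInter, Set.mem_Ici,
      Set.mem_compl_iff]
    by_cases h : ∃ n, 1 ≤ n ∧ T^[n] x ∈ A
    · refine ⟨fun hn => Or.inl ⟨_, ⟨(returnTime_spec h).1, hn⟩, (returnTime_spec h).2⟩, ?_⟩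
      rintro (⟨k, ⟨h1, h2⟩, h3⟩ | ⟨_, h2⟩)
      · exact (Nat.sInf_le ⟨h1, h3⟩ : returnTime T A x ≤ k).trans_lt h2
      · obtain ⟨k, hk, hk'⟩ := h
        exact absurd hk' (h2 k hk)
    · rw [returnTime_eq_zero h]
      refine ⟨fun hn => Or.inr ⟨hn, fun k hk hk' => h ⟨k, hk, hk'⟩⟩, ?_⟩
      rintro (⟨k, ⟨h1, h2⟩, h3⟩ | ⟨h1, _⟩)
      · lia
      · exact h1
  rw [this]
  refine .union (.biUnion (Set.to_countable _) fun k _ => hT.iterate k hA)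
    (.inter (.const _) (.biInter (Set.to_countable _) fun k _ => hT.iterate k hA.compl))

lemma measurable_inducedMap (hT : Measurable T) (hA : MeasurableSet A) :
    Measurable (inducedMap T A) := by
  intro D hD
  have : inducedMap T A ⁻¹' D = ⋃ n, returnTime T A ⁻¹' {n} ∩ T^[n] ⁻¹' D := by
    ext x; simp [inducedMap]
  rw [this]
  exact .iUnion fun n => (measurable_returnTime hT hA (measurableSet_singleton n)).inter
    (hT.iterate n hD)

lemma ae_forall_exists_return (hT : Conservative T m) (hA : MeasurableSet A) :
    ∀ᵐ x ∂m, x ∈ A → ∀ n, ∃ k, n < k ∧ T^[k] x ∈ A := by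
  filter_upwards [hT.ae_mem_imp_frequently_image_mem hA.nullMeasurableSet] with x hx hxA n
  obtain ⟨k, hk, hk'⟩ := (frequently_atTop.1 (hx hxA)) (n + 1)
  exact ⟨k, hk, hk'⟩

/-- The induced map does not increase the measure of preimages. The sets `Q n` of points
that reach `D` at time `n` and avoid `A` before satisfy
`m (Q n) ≥ m (A ∩ [φ_A = n + 1] ∩ T^(-n-1) D) + m (Q (n + 1))`. -/
lemma measure_inter_inducedMap_preimage_le (hT : MeasurePreserving T m m) (hc : Conservative T m)
    (hA : MeasurableSet A) {D : Set X} (hD : MeasurableSet D) :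
    m (A ∩ inducedMap T A ⁻¹' D) ≤ m D := by
  set Q : ℕ → Set X := fun n => {x | (∀ j < n, T^[j] x ∉ A) ∧ T^[n] x ∈ D} with hQ
  set E : ℕ → Set X := fun n => A ∩ (returnTime T A ⁻¹' {n + 1} ∩ T^[n + 1] ⁻¹' D) with hE
  have hEm : ∀ n, MeasurableSet (E n) := fun n => hA.inter
    ((measurable_returnTime hT.measurable hA (measurableSet_singleton _)).inter
      (hT.measurable.iterate _ hD))
  have hQm : ∀ n, MeasurableSet (Q n) := by
    intro n
    have : Q n = (⋂ j ∈ Set.Iio n, T^[j] ⁻¹' Aᶜ) ∩ T^[n] ⁻¹' D := by ext x; simp [hQ]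
    rw [this]
    exact .inter (.biInter (Set.to_countable _) fun k _ => hT.measurable.iterate k hA.compl)
      (hT.measurable.iterate _ hD)
  have hstep : ∀ n, m (E n) + m (Q (n + 1)) ≤ m (Q n) := by
    intro n
    rw [← measure_union _ (hQm _), ← hT.measure_preimage (hQm n).nullMeasurableSet]
    · refine measure_mono ?_
      rintro x (⟨_, hx2, hx3⟩ | ⟨hx1, hx2⟩)
      · have hx2 : returnTime T A x = n + 1 := hx2
        exact ⟨fun j hj => notMem_of_lt_returnTime (j := j + 1) (by lia) (by lia), hx3⟩
      · exact ⟨fun j hj => hx1 (j + 1) (by lia), hx2⟩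
    · exact Set.disjoint_left.2 fun x hx hx' => hx'.1 0 (by lia) hx.1
  have hsum : ∀ n, ∑ k ∈ Finset.range n, m (E k) + m (Q n) ≤ m D := by
    intro n
    induction n with
    | zero => simp [hQ]
    | succ n ih =>
      rw [Finset.sum_range_succ, add_assoc]
      exact (add_le_add le_rfl (hstep n)).trans ih
  calc m (A ∩ inducedMap T A ⁻¹' D) ≤ m (⋃ n, E n) := by
        refine measure_mono_ae ?_
        filter_upwards [ae_forall_exists_return hc hA] with x hx hx'
        obtain ⟨k, hk, hk'⟩ := hx hx'.1 0
        have hpos := (returnTime_spec ⟨k, hk, hk'⟩).1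
        refine Set.mem_iUnion.2 ⟨returnTime T A x - 1, hx'.1, ?_, ?_⟩
        · simp only [Set.mem_preimage, Set.mem_singleton_iff]; lia
        · rw [Nat.sub_add_cancel hpos]; exact hx'.2
    _ ≤ ∑' n, m (E n) := measure_iUnion_le _
    _ ≤ m D := ENNReal.tsum_le_of_sum_range_le fun n => le_self_add.trans (hsum n)

lemma measure_inter_inducedMap_iterate_preimage_le (hT : MeasurePreserving T m m)
    (hc : Conservative T m) (hA : MeasurableSet A) (k : ℕ) {D : Set X} (hD : MeasurableSet D) :
    m (A ∩ (inducedMap T A)^[k] ⁻¹' D) ≤ m D := by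
  induction k with
  | zero => exact measure_mono Set.inter_subset_right
  | succ k ih =>
    refine le_trans (measure_mono ?_) ((measure_inter_inducedMap_preimage_le hT hc hA
      (hA.inter ((measurable_inducedMap hT.measurable hA).iterate k hD))).trans ih)
    exact fun x ⟨hx, hx'⟩ => ⟨hx, mapsTo_inducedMap hx, hx'⟩

lemma tsum_indicator_lt_le (g : ℝ) :
    ∑' k : ℕ, (if (k : ℝ) < g then (1 : ℝ≥0∞) else 0) ≤ ENNReal.ofReal g + 1 := by
  rw [tsum_eq_sum (s := Finset.range ⌈g⌉₊) fun k hk => by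
    rw [if_neg]
    rw [Finset.mem_range, not_lt] at hk
    exact not_lt.2 (Nat.ceil_le.1 hk)]
  calc _ ≤ ∑ k ∈ Finset.range ⌈g⌉₊, (1 : ℝ≥0∞) :=
        Finset.sum_le_sum fun k _ => by split_ifs <;> simp
    _ = (⌈g⌉₊ : ℝ≥0∞) := by simp
    _ ≤ ENNReal.ofReal g + 1 := by
        rcases le_or_gt g 0 with h | h
        · simp [Nat.ceil_eq_zero.2 h]
        · rw [← ENNReal.ofReal_natCast, ← ENNReal.ofReal_one, ← ENNReal.ofReal_add h.le zero_le_one]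
          exact ENNReal.ofReal_le_ofReal (Nat.ceil_lt_add_one h.le).le

/-- If `log φ_A` is integrable on `A`, then it is `o(k)` along the orbits of the induced map. -/
lemma ae_eventually_log_returnTime_le (hT : MeasurePreserving T m m) (hc : Conservative T m)
    (hA : MeasurableSet A) (hA' : m A < ∞)
    (hlog : ∫⁻ x in A, ENNReal.ofReal (Real.log (returnTime T A x)) ∂m < ∞) (K : ℕ) :
    ∀ᵐ x ∂m, x ∈ A → ∀ᶠ k : ℕ in atTop,
      K * Real.log (returnTime T A ((inducedMap T A)^[k] x)) ≤ k := by
  set g : X → ℝ := fun x => K * Real.log (returnTime T A x) with hg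
  have hgm : Measurable g := ((Measurable.of_discrete (f := fun n : ℕ => Real.log n)).comp
    (measurable_returnTime hT.measurable hA)).const_mul _
  set D : ℕ → Set X := fun k => A ∩ {x | (k : ℝ) < g x} with hD
  have hDm : ∀ k, MeasurableSet (D k) := fun k => hA.inter (measurableSet_lt measurable_const hgm)
  have hsum : ∑' k, m (D k) ≠ ∞ := by
    have : ∀ k, m (D k) = ∫⁻ x in A, (if (k : ℝ) < g x then (1 : ℝ≥0∞) else 0) ∂m := by
      intro k
      have : (fun x => if (k : ℝ) < g x then (1 : ℝ≥0∞) else 0) =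
          Set.indicator {x | (k : ℝ) < g x} 1 := by
        ext x; simp [Set.indicator_apply]
      rw [this, lintegral_indicator_one (measurableSet_lt measurable_const hgm),
        Measure.restrict_apply (measurableSet_lt measurable_const hgm), Set.inter_comm]
    simp_rw [this]
    rw [← lintegral_tsum fun k => (Measurable.ite (measurableSet_lt measurable_const hgm)
      measurable_const measurable_const).aemeasurable]
    refine ((lintegral_mono fun x => tsum_indicator_lt_le (g x)).trans_lt ?_).ne
    rw [lintegral_add_right _ measurable_const, lintegral_const, Measure.restrict_apply_univ,
      one_mul]
    refine ENNReal.add_lt_top.2 ⟨?_, hA'⟩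
    simp_rw [hg, ENNReal.ofReal_mul (Nat.cast_nonneg K)]
    rw [lintegral_const_mul' _ _ ENNReal.ofReal_ne_top]
    exact ENNReal.mul_lt_top ENNReal.ofReal_lt_top hlog
  have hsum' : ∑' k, m (A ∩ (inducedMap T A)^[k] ⁻¹' D k) ≠ ∞ :=
    ((ENNReal.tsum_le_tsum fun k =>
      measure_inter_inducedMap_iterate_preimage_le hT hc hA k (hDm k)).trans_lt hsum.lt_top).ne
  filter_upwards [ae_eventually_notMem hsum'] with x hx hxA
  filter_upwards [hx] with k hk
  by_contra! h
  exact hk ⟨hxA, mapsTo_inducedMap.iterate k hxA, h⟩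

/-- For a log lower bounded conservative ergodic map, orbits visit every set `B` of positive finite
measure at least logarithmically often, with any prescribed constant. -/
lemma LogLowerBounded.frequently_le_exp_visits (h : LogLowerBounded T m) (hc : Conservative T m)
    (hT : Ergodic T m) {B : Set X} (hB : MeasurableSet B) (hB0 : 0 < m B) (hB' : m B < ∞) :
    ∃ᵐ x ∂m, ∃ C : ℝ, ∀ N : ℕ, (N : ℝ) ≤ C * Real.exp (visits T B N x / 2) := by
  obtain ⟨A, hA, hA0, hA', hlog⟩ := h
  have hfreq : ∃ᵐ x ∂m, x ∈ A := frequently_ae_mem_iff.2 hA0.ne'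
  have hall : ∀ᵐ x ∂m, ∀ K : ℕ, x ∈ A → ∀ᶠ k : ℕ in atTop,
      K * Real.log (returnTime T A ((inducedMap T A)^[k] x)) ≤ k :=
    ae_all_iff.2 fun K =>
      ae_eventually_log_returnTime_le hT.toMeasurePreserving hc hA hA' hlog K
  refine (hfreq.and_eventually ((ae_forall_exists_return hc hA).and
    (hall.and (ae_exists_visits_le hT hA hB hA' hB0 hB')))).mono ?_
  rintro x ⟨hxA, hret, hK, C, hC⟩
  -- the visits to `A` number at most `(C + 1) (b + 1)`, so this rate leaves half an exponent per
  -- visit to `B` after the factor `n` in front of the exponential is absorbed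
  obtain ⟨C', hC'0, hC'⟩ := birkhoffSum_returnTime_le (K := 4 * (C + 1)) (by lia)
    (hK (4 * (C + 1)) hxA)
  refine ⟨C' + 4 * (C + 1) * Real.exp (1 / 2), fun N => ?_⟩
  set n := visits T A N x with hn
  set b := visits T B N x with hb
  have h1 : N ≤ birkhoffSum (inducedMap T A) (returnTime T A) n x := by
    by_contra! hlt
    exact lt_irrefl _ (lt_visits_of_birkhoffSum_returnTime_lt hxA (hret hxA) hlt)
  have h2 : (N : ℝ) ≤ C' + n * Real.exp (n / (4 * (C + 1) : ℕ)) :=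
    (by exact_mod_cast h1 : (N : ℝ) ≤ _).trans (hC' n)
  set t : ℝ := n / (4 * (C + 1) : ℕ) with ht
  have hCpos : (0 : ℝ) < (4 * (C + 1) : ℕ) := by positivity
  have h3 : (n : ℝ) = (4 * (C + 1) : ℕ) * t := by rw [ht]; field_simp
  have h4 : t ≤ Real.exp t := by linarith [Real.add_one_le_exp t]
  have h5 : 2 * t ≤ (b + 1) / 2 := by
    have : (n : ℝ) ≤ (C + 1) * (b + 1) := by
      have h6 : n ≤ (C + 1) * (b + 1) := (hC N).trans (Nat.mul_le_mul (by lia) le_rfl)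
      exact_mod_cast h6
    rw [h3] at this
    push_cast at this
    have h7 : (0 : ℝ) < C + 1 := by positivity
    have : 4 * t ≤ b + 1 := by
      refine le_of_mul_le_mul_left ?_ h7
      linarith
    linarith
  have h6 : n * Real.exp t ≤ 4 * (C + 1) * Real.exp (1 / 2) * Real.exp (b / 2) := by
    rw [h3, mul_assoc, mul_assoc]
    push_cast
    refine mul_le_mul_of_nonneg_left ?_ (by positivity)
    calc t * Real.exp t ≤ Real.exp t * Real.exp t := by gcongr
      _ = Real.exp (2 * t) := by rw [← Real.exp_add]; ring_nf
      _ ≤ Real.exp (1 / 2 + b / 2) := Real.exp_le_exp.2 (by linarith)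
      _ = _ := Real.exp_add _ _
  have h7 : C' ≤ C' * Real.exp (b / 2) :=
    le_mul_of_one_le_right hC'0 (Real.one_le_exp (by positivity))
  linarith

end Induced

/-! ### The lacunary distribution -/

section Lacunary

lemma four_pow_four_pow_strictMono : StrictMono fun n : ℕ => 4 ^ 4 ^ n :=
  (pow_right_strictMono₀ (by norm_num)).comp (pow_right_strictMono₀ (by norm_num))

open Classical in
lemma lacunary_apply (A : Set ℕ+) :
    lacunary A = ∑' n : ℕ, if (4 : ℕ+) ^ 4 ^ (n + 1) ∈ A then (2 : ℝ≥0∞)⁻¹ ^ (n + 1) else 0 := by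
  rw [lacunary, Measure.sum_apply _ .of_discrete]
  refine tsum_congr fun n => ?_
  by_cases h : (4 : ℕ+) ^ 4 ^ (n + 1) ∈ A <;> simp [h]

/-- The mass that the lacunary distribution gives to `n`; zero for `n = 0`. -/
noncomputable def lacMass (n : ℕ) : ℝ≥0 := (lacunary {k | (k : ℕ) = n}).toNNReal

lemma coe_lacMass (n : ℕ) : (lacMass n : ℝ≥0∞) = lacunary {k | (k : ℕ) = n} :=
  ENNReal.coe_toNNReal (measure_ne_top _ _)

lemma lacMass_four_pow (i : ℕ) : lacMass (4 ^ 4 ^ (i + 1)) = (2 : ℝ≥0)⁻¹ ^ (i + 1) := by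
  rw [← ENNReal.coe_inj, coe_lacMass, lacunary_apply, tsum_eq_single i]
  · simp [ENNReal.inv_pow]
  · intro j hj
    have : ¬ (4 ^ 4 ^ (j + 1) = 4 ^ 4 ^ (i + 1)) := fun h =>
      hj (by simpa using four_pow_four_pow_strictMono.injective h)
    simp [this]

lemma lacMass_eq_zero {n : ℕ} (h : ∀ i, n ≠ 4 ^ 4 ^ (i + 1)) : lacMass n = 0 := by
  rw [← ENNReal.coe_inj, coe_lacMass, lacunary_apply, ENNReal.coe_zero, ENNReal.tsum_eq_zero]
  intro i
  have : ¬ (4 ^ 4 ^ (i + 1) = n) := fun h' => h i h'.symm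
  simp [this]

lemma tsum_inv_two_pow_add (m : ℕ) : ∑' i : ℕ, (2 : ℝ≥0∞)⁻¹ ^ (i + m + 1) = 2⁻¹ ^ m := by
  have : ∀ i : ℕ, (2 : ℝ≥0∞)⁻¹ ^ (i + m + 1) = 2⁻¹ ^ m * 2⁻¹ ^ (i + 1) := fun i => by
    rw [← pow_add]; congr 1; lia
  rw [tsum_congr this, ENNReal.tsum_mul_left, ENNReal.tsum_geometric_add_one,
    ENNReal.one_sub_inv_two, inv_inv, ENNReal.inv_mul_cancel (by norm_num) (by norm_num), mul_one]

lemma le_lacunary_tail {N m : ℕ} (h : N ≤ 4 ^ 4 ^ (m + 1)) :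
    (2 : ℝ≥0∞)⁻¹ ^ m ≤ lacunary {k | N ≤ (k : ℕ)} := by
  rw [lacunary_apply, ← tsum_inv_two_pow_add m]
  refine le_trans (ENNReal.tsum_le_tsum fun i => ?_)
    (ENNReal.tsum_comp_le_tsum_of_injective (add_left_injective m) _)
  have : N ≤ 4 ^ 4 ^ (i + m + 1) :=
    h.trans (four_pow_four_pow_strictMono.monotone (by lia))
  simp [this]

lemma lacunary_tail_le {N m : ℕ} (h : 4 ^ 4 ^ m < N) :
    lacunary {k | N ≤ (k : ℕ)} ≤ (2 : ℝ≥0∞)⁻¹ ^ m := by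
  rw [lacunary_apply, ← tsum_inv_two_pow_add m,
    ← (ENNReal.summable.sum_add_tsum_nat_add' (k := m)), Finset.sum_eq_zero, zero_add]
  · refine ENNReal.tsum_le_tsum fun i => ?_
    split_ifs <;> simp
  · intro i hi
    have : ¬ (N ≤ 4 ^ 4 ^ (i + 1)) := not_le.2
      (lt_of_le_of_lt (four_pow_four_pow_strictMono.monotone (Finset.mem_range.1 hi)) h)
    simp [this]

end Lacunary

/-! ### Failure of log lower boundedness -/

section NotLLB

variable {Ω : Type*} {φ : Ω → ℕ+} {S : Ω → Ω}

lemma visits_towerBase_height_le (ω : Ω) :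
    visits (towerMap S φ) (towerBase φ) (φ ω) (basePt φ ω) ≤ 1 := by
  rw [visits, birkhoffSum]
  refine (Finset.sum_le_sum (g := fun k => if k = 0 then 1 else 0) fun k hk => ?_).trans ?_
  · rw [towerMap_iterate_of_lt (basePt φ ω) k (by simpa [basePt] using Finset.mem_range.1 hk)]
    by_cases h : k = 0 <;> simp [towerBase, basePt, h]
  · rw [Finset.sum_ite_eq']
    split_ifs <;> simp

lemma visits_towerBase_birkhoffSum_le (ω : Ω) (n : ℕ) :
    visits (towerMap S φ) (towerBase φ) (birkhoffSum S (fun ω => (φ ω : ℕ)) n ω) (basePt φ ω) ≤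
      n := by
  induction n with
  | zero => simp [visits]
  | succ n ih =>
    have h := visits_towerBase_height_le (S := S) (φ := φ) (S^[n] ω)
    rw [visits] at h ih ⊢
    rw [birkhoffSum_succ, birkhoffSum_add, towerMap_iterate_birkhoffSum]
    exact Nat.add_le_add ih h

lemma visits_towerBase_le (x : Tower φ) {n N : ℕ}
    (hN : x.1.2 + N = birkhoffSum S (fun ω => (φ ω : ℕ)) n x.1.1) :
    visits (towerMap S φ) (towerBase φ) N x ≤ n := by
  refine le_trans ?_ (visits_towerBase_birkhoffSum_le (S := S) (φ := φ) x.1.1 n)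
  have hx : (towerMap S φ)^[x.1.2] (basePt φ x.1.1) = x := by
    rw [towerMap_iterate_of_lt _ _ (by simpa [basePt] using x.2)]
    simp [basePt]
  rw [← hN, visits, visits, birkhoffSum_add, hx]
  exact Nat.le_add_left _ _

variable [MeasurableSpace Ω]

lemma ae_towerMeasure {P : Measure Ω} [SFinite P] (hφ : Measurable φ) {p : Ω → Prop}
    (h : ∀ᵐ ω ∂P, p ω) : ∀ᵐ x ∂towerMeasure P φ, p x.1.1 := by
  set N := toMeasurable P {ω | ¬ p ω} with hN
  have hN0 : P N = 0 := by rw [hN, measure_toMeasurable]; exact h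
  have hm : MeasurableSet {x : Tower φ | x.1.1 ∈ N} :=
    (measurable_fst.comp measurable_subtype_coe) (measurableSet_toMeasurable _ _)
  refine measure_mono_null (t := {x : Tower φ | x.1.1 ∈ N})
    (fun x hx => subset_toMeasurable P _ hx) ?_
  rw [towerMeasure_apply P hφ hm, ENNReal.tsum_eq_zero]
  exact fun j => measure_mono_null (t := N) (fun ω ⟨_, hω⟩ => hω) hN0

end NotLLB

section Bernoulli

lemma lacunary_exp_tail_ge {l m : ℕ} (h : l ≤ 4 ^ m) :
    (2 : ℝ≥0∞)⁻¹ ^ m ≤ lacunary {k | Real.exp l ≤ (k : ℕ)} := by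
  refine (le_lacunary_tail (N := 4 ^ l) (m := m) ?_).trans (measure_mono fun k hk => ?_)
  · exact Nat.pow_le_pow_right (by norm_num) (h.trans (Nat.pow_le_pow_right (by norm_num) (by lia)))
  · have h1 : ((4 ^ l : ℕ) : ℝ) ≤ (k : ℕ) := by exact_mod_cast hk
    refine le_trans ?_ h1
    rw [← mul_one (l : ℝ), Real.exp_nat_mul, Nat.cast_pow]
    gcongr
    push_cast
    linarith [Real.exp_one_lt_d9]

/-- `log` of a lacunary random variable is not integrable, in the form needed for the second
Borel–Cantelli lemma. -/
lemma tsum_lacunary_exp_tail : ∑' l : ℕ, lacunary {k | Real.exp l ≤ (k : ℕ)} = ∞ := by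
  refine ENNReal.eq_top_of_forall_nnreal_le ?_
  intro r
  obtain ⟨m, hm⟩ := pow_unbounded_of_one_lt r (one_lt_two : (1 : ℝ≥0) < 2)
  calc (r : ℝ≥0∞) ≤ ((2 ^ m : ℝ≥0) : ℝ≥0∞) := by exact_mod_cast hm.le
    _ = ∑ l ∈ Finset.range (4 ^ m), (2 : ℝ≥0∞)⁻¹ ^ m := by
        have h4 : (4 : ℝ≥0∞) ^ m = 2 ^ m * 2 ^ m := by rw [← mul_pow]; norm_num
        rw [Finset.sum_const, Finset.card_range, nsmul_eq_mul]
        push_cast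
        rw [h4, mul_assoc, ← mul_pow 2, ENNReal.mul_inv_cancel (by norm_num) (by norm_num),
          one_pow, mul_one]
    _ ≤ ∑ l ∈ Finset.range (4 ^ m), lacunary {k | Real.exp l ≤ (k : ℕ)} :=
        Finset.sum_le_sum fun l hl => lacunary_exp_tail_ge (Finset.mem_range.1 hl).le
    _ ≤ _ := ENNReal.sum_le_tsum _

variable {I : Type*} [AddMonoidWithOne I]

lemma lacMeasure_towerBase : lacMeasure I (towerBase (height I)) = 1 := by
  rw [lacMeasure, towerMeasure_towerBase _ measurable_height, measure_univ]

lemma ae_frequently_exp_le [CharZero I] :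
    ∀ᵐ ω ∂bernoulliProduct I, ∃ᶠ l : ℕ in atTop, Real.exp l ≤ (ω (l : I) : ℕ) := by
  set s : ℕ → Set (I → ℕ+) := fun l => (fun ω => ω (l : I)) ⁻¹' {k | Real.exp l ≤ (k : ℕ)} with hs
  have hind : iIndepSet s (bernoulliProduct I) := by
    have h1 : iIndepFun (fun (i : I) (ω : I → ℕ+) => ω i) (bernoulliProduct I) :=
      iIndepFun_infinitePi (P := fun _ : I => lacunary) (X := fun _ k => k) fun _ => measurable_id
    have h2 := h1.precomp (g := fun l : ℕ => (l : I)) Nat.cast_injective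
    rw [iIndepSet_iff_meas_biInter (f := s) fun l => measurable_pi_apply (l : I) .of_discrete]
    intro t
    exact h2.measure_inter_preimage_eq_mul t fun _ _ => .of_discrete
  have hmeas : ∀ l, bernoulliProduct I (s l) = lacunary {k | Real.exp l ≤ (k : ℕ)} := fun l =>
    (measurePreserving_eval_infinitePi (fun _ : I => lacunary) (l : I)).measure_preimage
      (MeasurableSet.nullMeasurableSet .of_discrete)
  have h := measure_limsup_eq_one (s := s) (fun l => measurable_pi_apply (l : I) .of_discrete) hind
    (by simp_rw [hmeas]; exact tsum_lacunary_exp_tail)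
  have h' : ∀ᵐ ω ∂bernoulliProduct I, ω ∈ limsup s atTop := by
    rw [← prob_compl_eq_zero_iff] at h
    · exact h
    · exact MeasurableSet.measurableSet_limsup (s := s) fun l => measurable_pi_apply (l : I) .of_discrete
  filter_upwards [h'] with ω hω
  rwa [Filter.mem_limsup_iff_frequently_mem] at hω

variable [IsCancelAdd I]

lemma conservative_lacMap : Conservative (lacMap I) (lacMeasure I) :=
  conservative_towerMap measurable_height measurePreserving_shift

variable [CharZero I]

lemma ergodic_lacMap : Ergodic (lacMap I) (lacMeasure I) :=
  ergodic_towerMap measurable_height ergodic_shift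

/-- Log lower boundedness would force the `l`-th entrance to the base to occur before time
`C exp (l / 2)`, while the `l`-th height exceeds `exp l` infinitely often. -/
lemma not_logLowerBounded_lacMap : ¬ LogLowerBounded (lacMap I) (lacMeasure I) := by
  intro h
  have hfreq := h.frequently_le_exp_visits conservative_lacMap ergodic_lacMap
    (measurableSet_towerBase (height I)) (by rw [lacMeasure_towerBase]; exact one_pos)
    (by rw [lacMeasure_towerBase]; exact ENNReal.one_lt_top)
  obtain ⟨x, ⟨C, hC⟩, hx⟩ := (hfreq.and_eventually
    (ae_towerMeasure measurable_height (ae_frequently_exp_le (I := I)))).exists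
  have htop : Tendsto (fun l : ℕ => Real.exp ((l : ℝ) / 2)) atTop atTop :=
    Real.tendsto_exp_atTop.comp (tendsto_natCast_atTop_atTop.atTop_div_const (by norm_num))
  obtain ⟨l, hl, hl1, hl2⟩ := (hx.and_eventually ((eventually_ge_atTop 1).and
    (htop.eventually_gt_atTop (C * Real.exp (1 / 2))))).exists
  set τ := birkhoffSum (shift I) (fun ω => (height I ω : ℕ)) (l + 1) x.1.1 with hτ
  have hτ' : x.1.2 + (x.1.1 (l : I) : ℕ) ≤ τ := by
    have h0 : (x.1.2 : ℕ) < (height I x.1.1 : ℕ) := x.2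
    have h1 : (height I x.1.1 : ℕ) ≤ birkhoffSum (shift I) (fun ω => (height I ω : ℕ)) l x.1.1 :=
      Finset.single_le_sum (f := fun k => (height I ((shift I)^[k] x.1.1) : ℕ))
        (fun _ _ => Nat.zero_le _) (Finset.mem_range.2 hl1)
    rw [hτ, birkhoffSum_succ, height, shift_iterate_apply, zero_add]
    lia
  have hv : visits (lacMap I) (towerBase (height I)) (τ - x.1.2) x ≤ l + 1 :=
    visits_towerBase_le (S := shift I) x (by rw [← hτ]; lia)
  have hN : Real.exp l ≤ ((τ - x.1.2 : ℕ) : ℝ) :=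
    hl.trans (by exact_mod_cast (by lia : (x.1.1 (l : I) : ℕ) ≤ τ - x.1.2))
  have hCpos : 0 ≤ C := by
    by_contra! hneg
    have := (Nat.cast_nonneg _).trans (hC 0)
    nlinarith [Real.exp_pos ((visits (lacMap I) (towerBase (height I)) 0 x : ℝ) / 2)]
  have hv' : (visits (lacMap I) (towerBase (height I)) (τ - x.1.2) x : ℝ) ≤ l + 1 := by
    exact_mod_cast hv
  have h1 : Real.exp l ≤ C * Real.exp (1 / 2) * Real.exp (l / 2) := by
    refine (hN.trans (hC _)).trans ?_
    rw [mul_assoc, ← Real.exp_add]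
    refine mul_le_mul_of_nonneg_left (Real.exp_le_exp.2 ?_) hCpos
    linarith
  have h2 : Real.exp l = Real.exp (l / 2) * Real.exp (l / 2) := by
    rw [← Real.exp_add]; ring_nf
  rw [h2] at h1
  exact absurd (le_of_mul_le_mul_right h1 (Real.exp_pos _)) (not_le.2 hl2)

end Bernoulli

/-! ### Quasi finiteness -/

section QuasiFinite

variable {I : Type*} [AddMonoidWithOne I]

lemma tsum_negMulLog_lacMass_lt_top :
    ∑' n : ℕ, ENNReal.ofReal (Real.negMulLog (lacMass (n + 1))) < ∞ := by
  have hinj : Function.Injective fun i : ℕ => 4 ^ 4 ^ (i + 1) - 1 := by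
    intro i j hij
    have h : ∀ i : ℕ, 0 < 4 ^ 4 ^ (i + 1) := fun i => by positivity
    have : 4 ^ 4 ^ (i + 1) = 4 ^ 4 ^ (j + 1) := by
      have := h i; have := h j; simp only at hij; lia
    simpa using four_pow_four_pow_strictMono.injective this
  rw [← hinj.tsum_eq]
  · have hval : ∀ i : ℕ, Real.negMulLog (lacMass (4 ^ 4 ^ (i + 1) - 1 + 1)) =
        Real.log 2 * ((i + 1 : ℕ) * (2⁻¹ : ℝ) ^ (i + 1)) := by
      intro i
      rw [Nat.sub_add_cancel (Nat.one_le_pow _ _ (by norm_num)), lacMass_four_pow]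
      push_cast
      rw [Real.negMulLog, Real.log_pow, Real.log_inv]
      push_cast
      ring
    simp_rw [hval]
    refine Summable.tsum_ofReal_lt_top (Summable.mul_left _ ?_)
    have := summable_pow_mul_geometric_of_norm_lt_one 1 (r := (2⁻¹ : ℝ)) (by norm_num)
    simpa using (summable_nat_add_iff 1).2 this
  · intro n hn
    by_contra h
    refine hn ?_
    have h0 : lacMass (n + 1) = 0 := lacMass_eq_zero fun i hi => h ⟨i, by simp only; lia⟩
    simp [h0]

lemma slice_returnCell_towerBase (n : ℕ) :
    slice (returnCell (lacMap I) (towerBase (height I)) (n + 1)) 0 =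
      {ω | (height I ω : ℕ) = n + 1} := by
  ext ω
  have hlevel : ∀ k < (height I ω : ℕ), 1 ≤ k →
      (lacMap I)^[k] (basePt (height I) ω) ∉ towerBase (height I) := fun k hk hk1 => by
    rw [lacMap, towerMap_iterate_of_lt (basePt (height I) ω) k (by simpa [basePt] using hk)]
    simp [towerBase, basePt]
    lia
  have hexit : (lacMap I)^[(height I ω : ℕ)] (basePt (height I) ω) ∈ towerBase (height I) := by
    have := towerMap_iterate_exit (S := shift I) (basePt (height I) ω)
    simp only [basePt, Nat.sub_zero] at this
    rw [lacMap, basePt, this]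
    rfl
  constructor
  · rintro ⟨_, _, h2, h3⟩
    refine le_antisymm ?_ ?_
    · by_contra! h
      exact hlevel _ h (by lia) h2
    · by_contra! h
      exact h3 _ (height I ω).pos h hexit
  · intro h
    have h : (height I ω : ℕ) = n + 1 := h
    refine ⟨(height I ω).pos, rfl, ?_, fun j hj hj' => hlevel j (by lia) hj⟩
    rw [← h]
    exact hexit

lemma measurableSet_returnCell {X : Type*} [MeasurableSpace X] {T : X → X} (hT : Measurable T)
    {A : Set X} (hA : MeasurableSet A) (n : ℕ) : MeasurableSet (returnCell T A n) := by
  have : returnCell T A n = A ∩ (T^[n] ⁻¹' A ∩ ⋂ j ∈ Set.Ico 1 n, T^[j] ⁻¹' Aᶜ) := by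
    ext x; simp [returnCell]; tauto
  rw [this]
  exact hA.inter ((hT.iterate n hA).inter
    (.biInter (Set.to_countable _) fun j _ => hT.iterate j hA.compl))

lemma quasiFinite_lacMap [IsCancelAdd I] : QuasiFinite (lacMap I) (lacMeasure I) := by
  have hB := measurableSet_towerBase (height I)
  refine ⟨towerBase (height I), hB, by rw [lacMeasure_towerBase]; exact one_pos,
    by rw [lacMeasure_towerBase]; exact ENNReal.one_lt_top, ?_⟩
  have hcell : ∀ n, ((lacMeasure I)[|towerBase (height I)]).real
      (returnCell (lacMap I) (towerBase (height I)) (n + 1)) = lacMass (n + 1) := by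
    intro n
    have hm : MeasurableSet (returnCell (lacMap I) (towerBase (height I)) (n + 1)) :=
      measurableSet_returnCell (measurable_towerMap measurable_height
        measurePreserving_shift.measurable) hB (n + 1)
    rw [measureReal_def, cond_apply hB, lacMeasure_towerBase, inv_one, one_mul, Set.inter_comm,
      lacMeasure, towerMeasure_inter_towerBase _ measurable_height hm,
      slice_returnCell_towerBase]
    rw [lacMass, ENNReal.coe_toNNReal_eq_toReal]
    congr 1
    exact (measurePreserving_eval_infinitePi (fun _ : I => lacunary) (0 : I)).measure_preimage
      (s := {k : ℕ+ | (k : ℕ) = n + 1}) (MeasurableSet.nullMeasurableSet .of_discrete)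
  simp_rw [returnEntropy, hcell]
  exact tsum_negMulLog_lacMass_lt_top

end QuasiFinite

/-! ### The one-sided tower as a factor of the two-sided tower -/

section Factor

/-- The projection of a tower over `Ω` to a tower over `Ω'` with the same heights. -/
def towerProj {Ω Ω' : Type*} {φ : Ω → ℕ+} {φ' : Ω' → ℕ+} (π : Ω → Ω') (h : ∀ ω, φ' (π ω) = φ ω)
    (x : Tower φ) : Tower φ' := ⟨(π x.1.1, x.1.2), by rw [h]; exact x.2⟩

lemma measurePreserving_towerProj {Ω Ω' : Type*} [MeasurableSpace Ω] [MeasurableSpace Ω']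
    {P : Measure Ω} {P' : Measure Ω'} [SFinite P] [SFinite P'] {φ : Ω → ℕ+} {φ' : Ω' → ℕ+}
    (hφ : Measurable φ) (hφ' : Measurable φ') {π : Ω → Ω'} (h : ∀ ω, φ' (π ω) = φ ω)
    (hπ : MeasurePreserving π P P') :
    MeasurePreserving (towerProj π h) (towerMeasure P φ) (towerMeasure P' φ') := by
  have hm : Measurable (towerProj π h) :=
    (((hπ.measurable.comp measurable_fst).prodMk measurable_snd).comp
      measurable_subtype_coe).subtype_mk
  refine ⟨hm, Measure.ext fun A hA => ?_⟩
  rw [Measure.map_apply hm hA, towerMeasure_apply P hφ (hm hA), towerMeasure_apply P' hφ' hA]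
  refine tsum_congr fun j => ?_
  rw [← hπ.measure_preimage (measurableSet_slice hφ' hA j).nullMeasurableSet]
  congr 1
  ext ω
  simp [slice, towerProj, h]

lemma towerProj_towerMap {Ω Ω' : Type*} {φ : Ω → ℕ+} {φ' : Ω' → ℕ+} {π : Ω → Ω'}
    (h : ∀ ω, φ' (π ω) = φ ω) {S : Ω → Ω} {S' : Ω' → Ω'} (hS : ∀ ω, π (S ω) = S' (π ω))
    (x : Tower φ) : towerProj π h (towerMap S φ x) = towerMap S' φ' (towerProj π h x) := by
  by_cases hx : x.1.2 + 1 < (φ x.1.1 : ℕ)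
  · rw [towerMap_of_lt hx, towerMap_of_lt (by simpa [towerProj, h] using hx)]
    rfl
  · rw [towerMap_of_not_lt hx, towerMap_of_not_lt (by simpa [towerProj, h] using hx)]
    simp [towerProj, basePt, hS]

/-- The projection of the two-sided tower to the one-sided one forgets the past. -/
def forgetPast : lacTower ℤ → lacTower ℕ :=
  towerProj (fun ω (n : ℕ) => ω (n : ℤ)) fun _ => rfl

lemma measurePreserving_forgetPast :
    MeasurePreserving forgetPast (lacMeasure ℤ) (lacMeasure ℕ) :=
  measurePreserving_towerProj measurable_height measurable_height _
    (measurePreserving_reindex Nat.cast_injective)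

lemma forgetPast_lacMap (x : lacTower ℤ) : forgetPast (lacMap ℤ x) = lacMap ℕ (forgetPast x) :=
  towerProj_towerMap _ (fun ω => by ext n; simp [shift]) x

end Factor

/-! ### The renewal sequence of the lacunary distribution -/

section Renewal

/-- The density at level `j` of the `k`-th iterate of the transfer operator applied to the indicator
of the base of the one-sided tower. -/
noncomputable def levelDensity : ℕ → ℕ → ℝ≥0
  | 0, 0 => 1
  | 0, _ + 1 => 0
  | k + 1, 0 => ∑ j ∈ Finset.range (k + 1), lacMass (j + 1) * levelDensity k j
  | k + 1, j + 1 => levelDensity k j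

/-- The sum of the first `n` terms of the renewal sequence `k ↦ levelDensity k 0`, that is, the
expected number of renewals before time `n`. -/
noncomputable def renewalSum (n : ℕ) : ℝ≥0 := ∑ k ∈ Finset.range n, levelDensity k 0

/-- The tail `f {n, n + 1, …}` of the lacunary distribution. -/
noncomputable def lacTail (n : ℕ) : ℝ≥0 := (lacunary {k | n ≤ (k : ℕ)}).toNNReal

lemma coe_lacTail (n : ℕ) : (lacTail n : ℝ≥0∞) = lacunary {k | n ≤ (k : ℕ)} :=
  ENNReal.coe_toNNReal (measure_ne_top _ _)

lemma lacTail_one : lacTail 1 = 1 := by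
  rw [← ENNReal.coe_inj, coe_lacTail, ENNReal.coe_one]
  convert! measure_univ (μ := lacunary)
  ext k
  exact iff_of_true k.pos trivial

lemma lacTail_eq (n : ℕ) : lacTail n = lacMass n + lacTail (n + 1) := by
  rw [← ENNReal.coe_inj, ENNReal.coe_add, coe_lacTail, coe_lacTail, coe_lacMass,
    ← measure_union _ .of_discrete]
  · congr 1
    ext k
    simp only [Set.mem_ofPred_eq, Set.mem_union]
    lia
  · refine Set.disjoint_left.2 fun k h1 h2 => ?_
    have h1 : (k : ℕ) = n := h1
    have h2 : n + 1 ≤ (k : ℕ) := h2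
    lia

lemma lacTail_le_one (n : ℕ) : lacTail n ≤ 1 := by
  rw [← ENNReal.coe_le_coe, coe_lacTail, ENNReal.coe_one]
  exact prob_le_one

lemma lacTail_anti : Antitone lacTail :=
  antitone_nat_of_succ_le fun n => by rw [lacTail_eq n]; exact le_add_self

lemma le_lacTail {N m : ℕ} (h : N ≤ 4 ^ 4 ^ (m + 1)) : (2 : ℝ≥0)⁻¹ ^ m ≤ lacTail N := by
  rw [← ENNReal.coe_le_coe, coe_lacTail]
  simpa [ENNReal.inv_pow] using le_lacunary_tail h

lemma lacTail_le {N m : ℕ} (h : 4 ^ 4 ^ m < N) : lacTail N ≤ (2 : ℝ≥0)⁻¹ ^ m := by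
  rw [← ENNReal.coe_le_coe, coe_lacTail]
  simpa [ENNReal.inv_pow] using lacunary_tail_le h

lemma levelDensity_eq_zero {k j : ℕ} (h : k < j) : levelDensity k j = 0 := by
  induction k generalizing j with
  | zero =>
    obtain ⟨j, rfl⟩ := Nat.exists_eq_succ_of_ne_zero h.ne'
    rfl
  | succ k ih =>
    obtain ⟨j, rfl⟩ := Nat.exists_eq_succ_of_ne_zero (by lia : j ≠ 0)
    exact ih (by lia)

lemma sum_levelDensity (N j : ℕ) :
    ∑ k ∈ Finset.range N, levelDensity k j = renewalSum (N - j) := by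
  induction j generalizing N with
  | zero => rfl
  | succ j ih =>
    cases N with
    | zero => simp [renewalSum]
    | succ N =>
      rw [Finset.sum_range_succ', levelDensity, add_zero, Nat.add_sub_add_right, ← ih]
      rfl

lemma sum_levelDensity_level (n : ℕ) :
    ∑ j ∈ Finset.range (n + 1), levelDensity n j = renewalSum (n + 1) := by
  induction n with
  | zero => simp [renewalSum]
  | succ n ih =>
    rw [Finset.sum_range_succ', renewalSum, Finset.sum_range_succ _ (n + 1), ← renewalSum, ← ih]
    rfl

/-- The iterates of the transfer operator preserve total mass. -/
lemma sum_levelDensity_mul_lacTail (n : ℕ) :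
    ∑ j ∈ Finset.range (n + 1), levelDensity n j * lacTail (j + 1) = 1 := by
  induction n with
  | zero => simp [levelDensity, lacTail_one]
  | succ n ih =>
    rw [Finset.sum_range_succ', zero_add, lacTail_one, mul_one]
    simp only [levelDensity]
    rw [← Finset.sum_add_distrib, ← ih]
    refine Finset.sum_congr rfl fun j _ => ?_
    rw [lacTail_eq (j + 1)]
    ring

lemma levelDensity_zero_right_le_one (k : ℕ) : levelDensity k 0 ≤ 1 := by
  rw [← sum_levelDensity_mul_lacTail k]
  refine le_trans ?_ (Finset.single_le_sum (fun _ _ => zero_le) (Finset.mem_range.2 k.succ_pos))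
  rw [zero_add, lacTail_one, mul_one]

lemma renewalSum_mono : Monotone renewalSum := fun _ _ h =>
  Finset.sum_le_sum_of_subset (Finset.range_mono h)

/-- The terms of the renewal sequence are at most one. -/
lemma renewalSum_le_add (n j : ℕ) : renewalSum n ≤ renewalSum (n - j) + j := by
  rcases le_total n j with h | h
  · refine le_trans ?_ le_add_self
    refine (Finset.sum_le_sum fun k _ => levelDensity_zero_right_le_one k).trans ?_
    simpa using h
  · obtain ⟨i, rfl⟩ := Nat.exists_eq_add_of_le' h
    rw [Nat.add_sub_cancel, renewalSum, Finset.sum_range_add, ← renewalSum]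
    gcongr
    refine (Finset.sum_le_sum fun k _ => levelDensity_zero_right_le_one _).trans ?_
    simp

/-- In the conservation of mass all tails up to time `n` are at least the last one. -/
lemma renewalSum_mul_lacTail_le (n : ℕ) : renewalSum n * lacTail n ≤ 1 := by
  cases n with
  | zero => simp [renewalSum]
  | succ n =>
    rw [← sum_levelDensity_level, ← sum_levelDensity_mul_lacTail n, Finset.sum_mul]
    refine Finset.sum_le_sum fun j hj => mul_le_mul_right (lacTail_anti ?_) _
    have := Finset.mem_range.1 hj
    lia

/-- Summation of the conservation of mass over the first `N` times. -/
lemma le_renewalSum_mul_sum_lacTail (N : ℕ) :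
    (N : ℝ≥0) ≤ renewalSum N * ∑ j ∈ Finset.range N, lacTail (j + 1) := by
  calc (N : ℝ≥0) = ∑ n ∈ Finset.range N, ∑ j ∈ Finset.range (n + 1),
          levelDensity n j * lacTail (j + 1) := by
        simp [sum_levelDensity_mul_lacTail]
    _ = ∑ n ∈ Finset.range N, ∑ j ∈ Finset.range N, levelDensity n j * lacTail (j + 1) := by
        refine Finset.sum_congr rfl fun n hn => ?_
        refine Finset.sum_subset (Finset.range_mono (Finset.mem_range.1 hn)) fun j _ hj => ?_
        rw [levelDensity_eq_zero (by simpa using hj), zero_mul]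
    _ = ∑ j ∈ Finset.range N, renewalSum (N - j) * lacTail (j + 1) := by
        rw [Finset.sum_comm]
        simp_rw [← Finset.sum_mul, sum_levelDensity]
    _ ≤ ∑ j ∈ Finset.range N, renewalSum N * lacTail (j + 1) :=
        Finset.sum_le_sum fun j _ => mul_le_mul_left (renewalSum_mono (Nat.sub_le _ _)) _
    _ = _ := by rw [Finset.mul_sum]

lemma exists_four_pow_bracket {n : ℕ} (hn : 4 ^ 4 ^ 1 < n) :
    ∃ m, 4 ^ 4 ^ (m + 1) < n ∧ n ≤ 4 ^ 4 ^ (m + 2) := by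
  have hex : ∃ m, n ≤ 4 ^ 4 ^ m := by
    obtain ⟨m, hm⟩ := (four_pow_four_pow_strictMono.tendsto_atTop.eventually_ge_atTop n).exists
    exact ⟨m, hm⟩
  classical
  have h2 : 1 < Nat.find hex := by
    by_contra! h
    exact absurd ((Nat.find_spec hex).trans (four_pow_four_pow_strictMono.monotone h)) (not_le.2 hn)
  obtain ⟨m, hm⟩ := Nat.exists_eq_add_of_le' h2
  refine ⟨m, not_le.1 (Nat.find_min hex (by lia)), ?_⟩
  have := Nat.find_spec hex
  rwa [hm] at this

lemma renewalSum_le {n m : ℕ} (h : n ≤ 4 ^ 4 ^ (m + 1)) : renewalSum n ≤ 2 ^ m := by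
  have h1 := (mul_le_mul_right (le_lacTail h) (renewalSum n)).trans (renewalSum_mul_lacTail_le n)
  rw [inv_pow] at h1
  simpa using (mul_inv_le_iff₀ (by positivity)).1 h1

/-- The truncated mean `∑_{j ≤ n} f {j, j + 1, …}` is at most `4 ^ 4 ^ m + n 2⁻ᵐ ≤ 2 n 2⁻ᵐ`. -/
lemma le_renewalSum {n m : ℕ} (h : 4 ^ 4 ^ (m + 1) < n) : (2 : ℝ) ^ m ≤ 2 * renewalSum n := by
  have h1 : ∑ j ∈ Finset.range n, lacTail (j + 1) ≤ 4 ^ 4 ^ m + n * 2⁻¹ ^ m := by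
    calc ∑ j ∈ Finset.range n, lacTail (j + 1)
        ≤ ∑ j ∈ Finset.range n, ((if j < 4 ^ 4 ^ m then 1 else 0) + 2⁻¹ ^ m) := by
          refine Finset.sum_le_sum fun j _ => ?_
          split_ifs with hj
          · exact (lacTail_le_one _).trans le_self_add
          · rw [zero_add]
            exact lacTail_le (by lia)
      _ = ∑ j ∈ Finset.range n, (if j < 4 ^ 4 ^ m then 1 else 0) + n * 2⁻¹ ^ m := by
          rw [Finset.sum_add_distrib]; simp
      _ ≤ 4 ^ 4 ^ m + n * 2⁻¹ ^ m := by
          gcongr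
          rw [← Finset.sum_filter, Finset.sum_const, nsmul_eq_mul, mul_one]
          have : ((Finset.range n).filter (· < 4 ^ 4 ^ m)).card ≤ 4 ^ 4 ^ m := by
            rw [← Finset.card_range (4 ^ 4 ^ m)]
            exact Finset.card_le_card fun j hj => by simpa using (Finset.mem_filter.1 hj).2
          exact_mod_cast this
  have h2 : (4 ^ 4 ^ m * 2 ^ m : ℕ) ≤ n := by
    refine le_trans ?_ h.le
    calc 4 ^ 4 ^ m * 2 ^ m ≤ 4 ^ 4 ^ m * 4 ^ 4 ^ m := by
          have h4 : m ≤ 4 ^ m := (Nat.lt_pow_self (by norm_num)).le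
          exact Nat.mul_le_mul le_rfl ((Nat.pow_le_pow_left (by norm_num) m).trans
            (Nat.pow_le_pow_right (by norm_num) h4))
      _ = 4 ^ (2 * 4 ^ m) := by rw [← pow_add]; ring_nf
      _ ≤ 4 ^ 4 ^ (m + 1) := by
          gcongr
          · norm_num
          · rw [pow_succ]; lia
  have h3 : (n : ℝ) ≤ renewalSum n * (4 ^ 4 ^ m + n * 2⁻¹ ^ m) := by
    exact_mod_cast (le_renewalSum_mul_sum_lacTail n).trans (mul_le_mul_right h1 _)
  have h4 : (4 : ℝ) ^ 4 ^ m ≤ n * 2⁻¹ ^ m := by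
    rw [inv_pow, ← div_eq_mul_inv, le_div_iff₀ (by positivity)]
    exact_mod_cast h2
  have hn : (0 : ℝ) < n := by exact_mod_cast (Nat.zero_le _).trans_lt h
  have h5 : (n : ℝ) ≤ renewalSum n * (2 * (n * 2⁻¹ ^ m)) :=
    h3.trans (mul_le_mul_of_nonneg_left (by linarith) (NNReal.coe_nonneg _))
  have h6 : (n : ℝ) * 2 ^ m ≤ n * (2 * renewalSum n) := by
    calc (n : ℝ) * 2 ^ m ≤ renewalSum n * (2 * (n * 2⁻¹ ^ m)) * 2 ^ m := by gcongr
      _ = n * (2 * renewalSum n) * (2⁻¹ ^ m * 2 ^ m) := by ring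
      _ = n * (2 * renewalSum n) := by rw [← mul_pow]; norm_num
  exact le_of_mul_le_mul_left h6 hn

lemma renewalSum_isTheta :
    (fun n => (renewalSum n : ℝ)) =Θ[atTop] fun n : ℕ => Real.sqrt (Real.log n) := by
  have hlog4 : 1 ≤ Real.log 4 ∧ Real.log 4 ≤ 4 := by
    constructor
    · rw [Real.le_log_iff_exp_le (by norm_num)]
      linarith [Real.exp_one_lt_d9]
    · exact (Real.log_le_self (by norm_num))
  have key : ∀ n : ℕ, 4 ^ 4 ^ 1 < n → (renewalSum n : ℝ) ≤ Real.sqrt (Real.log n) ∧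
      Real.sqrt (Real.log n) ≤ 16 * renewalSum n := by
    intro n hn
    obtain ⟨m, hm1, hm2⟩ := exists_four_pow_bracket hn
    have hsq : ∀ i : ℕ, ((2 : ℝ) ^ i) ^ 2 = 4 ^ i := fun i => by
      rw [← pow_mul, mul_comm, pow_mul]; norm_num
    have hnpos : (0 : ℝ) < n := by exact_mod_cast (Nat.zero_le _).trans_lt hn
    constructor
    · have h1 : (renewalSum n : ℝ) ≤ 2 ^ (m + 1) := by exact_mod_cast renewalSum_le hm2
      refine h1.trans (Real.le_sqrt_of_sq_le ?_)
      have h2 : Real.log ((4 ^ 4 ^ (m + 1) : ℕ) : ℝ) ≤ Real.log n :=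
        Real.log_le_log (by positivity) (by exact_mod_cast hm1.le)
      rw [Nat.cast_pow, Real.log_pow] at h2
      push_cast at h2
      rw [hsq]
      exact (le_mul_of_one_le_right (by positivity) hlog4.1).trans h2
    · have h1 := le_renewalSum hm1
      have h2 : Real.log n ≤ Real.log ((4 ^ 4 ^ (m + 2) : ℕ) : ℝ) :=
        Real.log_le_log hnpos (by exact_mod_cast hm2)
      rw [Nat.cast_pow, Real.log_pow] at h2
      push_cast at h2
      have h3 : Real.sqrt (Real.log n) ≤ 2 ^ (m + 3) := by
        refine Real.sqrt_le_iff.2 ⟨by positivity, ?_⟩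
        rw [hsq, pow_succ 4 (m + 2)]
        exact h2.trans (mul_le_mul_of_nonneg_left hlog4.2 (by positivity))
      refine h3.trans ?_
      rw [pow_add]
      linarith
  constructor
  · refine IsBigO.of_bound 1 ?_
    filter_upwards [eventually_gt_atTop (4 ^ 4 ^ 1)] with n hn
    rw [Real.norm_of_nonneg (NNReal.coe_nonneg _), Real.norm_of_nonneg (Real.sqrt_nonneg _),
      one_mul]
    exact (key n hn).1
  · refine IsBigO.of_bound 16 ?_
    filter_upwards [eventually_gt_atTop (4 ^ 4 ^ 1)] with n hn
    rw [Real.norm_of_nonneg (NNReal.coe_nonneg _), Real.norm_of_nonneg (Real.sqrt_nonneg _)]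
    exact (key n hn).2

lemma tendsto_renewalSum : Tendsto (fun n => (renewalSum n : ℝ)) atTop atTop := by
  have h : Tendsto (fun n : ℕ => Real.sqrt (Real.log n)) atTop atTop :=
    Real.tendsto_sqrt_atTop.comp (Real.tendsto_log_atTop.comp tendsto_natCast_atTop_atTop)
  have h' := renewalSum_isTheta.tendsto_norm_atTop_iff.2 (tendsto_norm_atTop_atTop.comp h)
  exact h'.congr fun n => Real.norm_of_nonneg (NNReal.coe_nonneg _)

lemma renewalSum_pos {n : ℕ} (hn : 1 ≤ n) : 0 < renewalSum n :=
  lt_of_lt_of_le (by simp [renewalSum, levelDensity]) (renewalSum_mono hn)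

end Renewal

/-! ### The transfer operator of the one-sided tower -/

section Transfer

lemma transfer_congr {X : Type*} [MeasurableSpace X] {m : Measure X} (T : X → X) {f g : X → ℝ}
    (h : f =ᵐ[m] g) : transfer T m f = transfer T m g := by
  rw [transfer, transfer, WithDensityᵥEq.congr_ae h]

/-- For nonnegative functions the transfer operator may be computed from integrals over preimages. -/
lemma transfer_ae_eq {X : Type*} [MeasurableSpace X] {m : Measure X} [SigmaFinite m] {T : X → X}
    (hT : Measurable T) {f g : X → ℝ≥0∞} (hf : Measurable f) (hg : Measurable g)
    (hfi : ∫⁻ x, f x ∂m ≠ ∞)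
    (h : ∀ A, MeasurableSet A → ∫⁻ x in T ⁻¹' A, f x ∂m = ∫⁻ x in A, g x ∂m) :
    transfer T m (fun x => (f x).toReal) =ᵐ[m] fun x => (g x).toReal := by
  have hgi : ∫⁻ x, g x ∂m ≠ ∞ := by
    have := h Set.univ MeasurableSet.univ
    simp only [Set.preimage_univ, Measure.restrict_univ] at this
    rwa [← this]
  have := isFiniteMeasure_withDensity hfi
  have := isFiniteMeasure_withDensity hgi
  refine (SignedMeasure.eq_rnDeriv 0 _ (integrable_toReal_of_lintegral_ne_top hg.aemeasurable hgi)
    VectorMeasure.MutuallySingular.zero_left ?_).symm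
  rw [zero_add, withDensityᵥ_toReal hf.aemeasurable hfi, withDensityᵥ_toReal hg.aemeasurable hgi]
  ext A hA
  rw [VectorMeasure.map_apply _ hT hA, Measure.toSignedMeasure_apply_measurable (hT hA),
    Measure.toSignedMeasure_apply_measurable hA, measureReal_def, measureReal_def,
    withDensity_apply _ (hT hA), withDensity_apply _ hA, h A hA]

lemma setLIntegral_level {Ω : Type*} [MeasurableSpace Ω] (P : Measure Ω) [SFinite P] {φ : Ω → ℕ+}
    (hφ : Measurable φ) (c : ℕ → ℝ≥0∞) {A : Set (Tower φ)} (hA : MeasurableSet A) :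
    ∫⁻ x in A, c x.1.2 ∂towerMeasure P φ = ∑' j, c j * P (slice A j) := by
  have hlev : Measurable fun x : Tower φ => x.1.2 := measurable_snd.comp measurable_subtype_coe
  have hm : ∀ j, MeasurableSet {x : Tower φ | x.1.2 = j} := fun j =>
    hlev (measurableSet_singleton j)
  have h1 : ∀ x : Tower φ, c x.1.2 = ∑' j, {x : Tower φ | x.1.2 = j}.indicator (fun _ => c j) x := by
    intro x
    rw [tsum_eq_single x.1.2]
    · simp
    · intro j hj
      exact Set.indicator_of_notMem (fun h => hj h.symm) _
  simp_rw [h1]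
  rw [lintegral_tsum fun j => (measurable_const.indicator (hm j)).aemeasurable]
  refine tsum_congr fun j => ?_
  rw [lintegral_indicator_const (hm j), Measure.restrict_apply (hm j),
    towerMeasure_apply P hφ ((hm j).inter hA), tsum_eq_single j]
  · congr 2
    ext ω
    simp [slice]
  · intro i hi
    convert! measure_empty (μ := P)
    ext ω
    simp [slice, hi]

/-- Under the one-sided product measure the zeroth coordinate is independent of the shifted
sequence. -/
lemma bernoulliProduct_inter_shift_preimage (n : ℕ) {B : Set (ℕ → ℕ+)} (hB : MeasurableSet B) :
    bernoulliProduct ℕ ({ω | (height ℕ ω : ℕ) = n} ∩ shift ℕ ⁻¹' B) =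
      lacMass n * bernoulliProduct ℕ B := by
  have hS : Measurable (shift ℕ : (ℕ → ℕ+) → ℕ → ℕ+) := measurePreserving_shift.measurable
  set V : Set ℕ+ := {k | (k : ℕ) = n} with hV
  set μ₁ : Measure (ℕ → ℕ+) :=
    ((bernoulliProduct ℕ).restrict {ω | (height ℕ ω : ℕ) = n}).map (shift ℕ) with hμ₁
  have happ : ∀ B, MeasurableSet B → μ₁ B =
      bernoulliProduct ℕ ({ω | (height ℕ ω : ℕ) = n} ∩ shift ℕ ⁻¹' B) := fun B hB => by
    rw [hμ₁, Measure.map_apply hS hB, Measure.restrict_apply (hS hB), Set.inter_comm]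
  have hbox : ∀ (s : Finset ℕ) (t : ℕ → Set ℕ+), μ₁ (Set.pi s t) =
      lacMass n * bernoulliProduct ℕ (Set.pi s t) := by
    intro s t
    rw [happ _ (.pi s.countable_toSet fun _ _ => .of_discrete)]
    set u : ℕ → Set ℕ+ := fun k => Nat.casesOn k V t with hu
    have hset : {ω : ℕ → ℕ+ | (height ℕ ω : ℕ) = n} ∩ shift ℕ ⁻¹' (Set.pi s t) =
        Set.pi (insert 0 (s.image Nat.succ) : Finset ℕ) u := by
      ext ω
      simp [hu, hV, height, shift, Set.mem_pi]
    rw [hset, bernoulliProduct, Measure.infinitePi_pi _ fun _ _ => .of_discrete,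
      Measure.infinitePi_pi _ fun _ _ => .of_discrete, Finset.prod_insert (by simp),
      Finset.prod_image fun _ _ _ _ h => Nat.succ_injective h, coe_lacMass]
    rfl
  have : μ₁ = (lacMass n : ℝ≥0∞) • bernoulliProduct ℕ := by
    refine ext_of_generate_finite _ (generateFrom_squareCylinders (α := fun _ : ℕ => ℕ+)).symm
      (isPiSystem_squareCylinders (fun _ => MeasurableSpace.isPiSystem_measurableSet) (by simp))
      ?_ ?_
    · rintro _ ⟨s, t, -, rfl⟩
      simpa using hbox s t
    · simpa using hbox ∅ fun _ => Set.univ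
  rw [← happ B hB, this]
  rfl

lemma setLIntegral_levelDensity_preimage (k : ℕ) {A : Set (lacTower ℕ)} (hA : MeasurableSet A) :
    ∫⁻ x in lacMap ℕ ⁻¹' A, (levelDensity k x.1.2 : ℝ≥0∞) ∂lacMeasure ℕ =
      ∫⁻ x in A, (levelDensity (k + 1) x.1.2 : ℝ≥0∞) ∂lacMeasure ℕ := by
  have hT : Measurable (lacMap ℕ) :=
    measurable_towerMap measurable_height measurePreserving_shift.measurable
  have h0 := measurableSet_slice measurable_height hA 0
  rw [lacMeasure, setLIntegral_level _ measurable_height (fun j => (levelDensity k j : ℝ≥0∞)) (hT hA),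
    setLIntegral_level _ measurable_height (fun j => (levelDensity (k + 1) j : ℝ≥0∞)) hA,
    tsum_eq_zero_add' (f := fun j => (levelDensity (k + 1) j : ℝ≥0∞) *
      bernoulliProduct ℕ (slice A j)) ENNReal.summable, add_comm]
  have hstep : ∀ j, (levelDensity k j : ℝ≥0∞) * bernoulliProduct ℕ (slice (lacMap ℕ ⁻¹' A) j) =
      levelDensity k j * bernoulliProduct ℕ (slice A (j + 1)) +
        (levelDensity k j * lacMass (j + 1)) * bernoulliProduct ℕ (slice A 0) := by
    intro j
    rw [lacMap, measure_slice_preimage _ measurable_height measurePreserving_shift.measurable hA,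
      bernoulliProduct_inter_shift_preimage (j + 1) h0, mul_add, mul_assoc]
  rw [tsum_congr hstep, ENNReal.tsum_add, ENNReal.tsum_mul_right]
  congr 2
  rw [tsum_eq_sum (s := Finset.range (k + 1)) fun j hj => by
    rw [levelDensity_eq_zero (by simpa using hj)]; simp]
  simp only [levelDensity]
  push_cast
  exact Finset.sum_congr rfl fun j _ => mul_comm _ _

lemma measurable_level (c : ℕ → ℝ≥0) :
    Measurable fun x : lacTower ℕ => (c x.1.2 : ℝ≥0∞) :=
  (Measurable.of_discrete (f := fun j => (c j : ℝ≥0∞))).comp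
    (measurable_snd.comp measurable_subtype_coe)

instance (I : Type*) [AddMonoidWithOne I] : SigmaFinite (lacMeasure I) :=
  sigmaFinite_towerMeasure _ measurable_height

lemma lintegral_levelDensity (k : ℕ) :
    ∫⁻ x, (levelDensity k x.1.2 : ℝ≥0∞) ∂lacMeasure ℕ = 1 := by
  induction k with
  | zero =>
    rw [← setLIntegral_univ, lacMeasure, setLIntegral_level _ measurable_height
      (fun j => (levelDensity 0 j : ℝ≥0∞)) MeasurableSet.univ, tsum_eq_single 0]
    · have : slice (Set.univ : Set (lacTower ℕ)) 0 = Set.univ := by ext ω; simp [slice]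
      rw [this]
      simp [levelDensity]
    · intro j hj
      rw [levelDensity_eq_zero (Nat.pos_of_ne_zero hj)]
      simp
  | succ k ih =>
    rw [← ih, ← setLIntegral_univ, ← setLIntegral_levelDensity_preimage k MeasurableSet.univ]
    simp

lemma transfer_levelDensity (k : ℕ) :
    transfer (lacMap ℕ) (lacMeasure ℕ) (fun x => (levelDensity k x.1.2 : ℝ)) =ᵐ[lacMeasure ℕ]
      fun x => (levelDensity (k + 1) x.1.2 : ℝ) := by
  have := transfer_ae_eq (m := lacMeasure ℕ) (T := lacMap ℕ)
    (measurable_towerMap measurable_height measurePreserving_shift.measurable)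
    (measurable_level (levelDensity k)) (measurable_level (levelDensity (k + 1)))
    (by rw [lintegral_levelDensity]; exact ENNReal.one_ne_top)
    (fun A hA => setLIntegral_levelDensity_preimage k hA)
  simpa using this

lemma transfer_iterate_levelDensity (k : ℕ) :
    (transfer (lacMap ℕ) (lacMeasure ℕ))^[k] (fun x => (levelDensity 0 x.1.2 : ℝ))
      =ᵐ[lacMeasure ℕ] fun x => (levelDensity k x.1.2 : ℝ) := by
  induction k with
  | zero => rfl
  | succ k ih =>
    rw [Function.iterate_succ_apply', transfer_congr _ ih]
    exact transfer_levelDensity k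

lemma isReturnSequence_renewalSum :
    IsReturnSequence (lacMap ℕ) (lacMeasure ℕ) fun n => (renewalSum n : ℝ) := by
  have hint : ∫ x, (levelDensity 0 x.1.2 : ℝ) ∂lacMeasure ℕ = 1 := by
    have := integral_toReal (μ := lacMeasure ℕ) (measurable_level (levelDensity 0)).aemeasurable
      (Eventually.of_forall fun x => ENNReal.coe_lt_top)
    simpa [lintegral_levelDensity] using this
  refine ⟨fun n hn => by exact_mod_cast renewalSum_pos hn,
    fun x => (levelDensity 0 x.1.2 : ℝ), ?_, Eventually.of_forall fun x => NNReal.coe_nonneg _,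
    by rw [hint]; exact one_pos, ?_⟩
  · have := integrable_toReal_of_lintegral_ne_top (μ := lacMeasure ℕ)
      (measurable_level (levelDensity 0)).aemeasurable
      (by rw [lintegral_levelDensity]; exact ENNReal.one_ne_top)
    simpa using this
  rw [hint]
  filter_upwards [ae_all_iff.2 transfer_iterate_levelDensity] with x hx
  simp_rw [hx]
  set j := x.1.2
  have hsum : ∀ n, ∑ k ∈ Finset.range n, (levelDensity k j : ℝ) = renewalSum (n - j) := fun n => by
    rw [← sum_levelDensity]; push_cast; rfl
  simp_rw [hsum]
  -- passing from `n - j` to `n` adds at most `j` to a sum that tends to infinity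
  have hlow : Tendsto (fun n => 1 - (j : ℝ) / renewalSum n) atTop (𝓝 1) := by
    simpa using (tendsto_const_nhds (x := (1 : ℝ))).sub
      (tendsto_renewalSum.const_div_atTop (j : ℝ))
  refine tendsto_of_tendsto_of_tendsto_of_le_of_le' hlow tendsto_const_nhds ?_ ?_
  · filter_upwards [eventually_ge_atTop 1] with n hn
    have hpos : (0 : ℝ) < renewalSum n := by exact_mod_cast renewalSum_pos hn
    have h : (renewalSum n : ℝ) ≤ renewalSum (n - j) + j := by exact_mod_cast renewalSum_le_add n j
    rw [one_sub_div hpos.ne', one_div, ← div_eq_inv_mul]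
    gcongr
    linarith
  · filter_upwards [eventually_ge_atTop 1] with n hn
    have hpos : (0 : ℝ) < renewalSum n := by exact_mod_cast renewalSum_pos hn
    have h : (renewalSum (n - j) : ℝ) ≤ renewalSum n := by
      exact_mod_cast renewalSum_mono (Nat.sub_le n j)
    rw [one_div, ← div_eq_inv_mul]
    exact (div_le_one hpos).2 h

end Transfer

/-! ### Markov shift structure -/

section Coding

/-- An injective measurable equivariant coding by sequences is an isomorphism onto the shift with
the image measure, since it is a measurable embedding of standard Borel spaces. -/
lemma isIsomorphic_shift_of_injective {X : Type*} [MeasurableSpace X] [StandardBorelSpace X]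
    [Nonempty X] {I : Type*} [AddMonoidWithOne I] [Countable I] {Y : Type*} [MeasurableSpace Y]
    [Countable Y] [DiscreteMeasurableSpace Y] {T : X → X} {m : Measure X} {Φ : X → I → Y}
    (hΦ : Measurable Φ) (hinj : Function.Injective Φ) (hT : ∀ x, Φ (T x) = shift I (Φ x)) :
    IsIsomorphic T m (shift I) (m.map Φ) := by
  have hE : MeasurableEmbedding Φ := hΦ.measurableEmbedding hinj
  obtain ⟨Ψ, hΨ, hinv⟩ := hE.exists_measurable_extend (measurable_id (α := X))
    fun _ => inferInstance
  have hinv' : ∀ x, Ψ (Φ x) = x := fun x => congrFun hinv x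
  refine ⟨Φ, Ψ, ⟨hΦ, rfl⟩, ⟨hΨ, ?_⟩, Eventually.of_forall hinv', ?_, Eventually.of_forall hT⟩
  · rw [Measure.map_map hΨ hΦ, hinv, Measure.map_id]
  · rw [hE.ae_map_iff]
    exact Eventually.of_forall fun x => by rw [hinv']

/-- The states of the Markov chain of the tower: a height and a level below it. -/
abbrev TowerState : Type := {s : ℕ+ × ℕ // s.2 < (s.1 : ℕ)}

variable {I : Type*} [AddMonoidWithOne I]

/-- The current height and the current level of a point of the tower. -/
def towerState (x : lacTower I) : TowerState := ⟨(height I x.1.1, x.1.2), x.2⟩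

lemma measurable_towerState : Measurable (towerState : lacTower I → TowerState) :=
  (((measurable_height.comp measurable_fst).prodMk measurable_snd).comp
    measurable_subtype_coe).subtype_mk

/-- The chain climbs deterministically to the top level and then jumps to level zero with a new
independent height. -/
noncomputable def towerTransition (s t : TowerState) : ℝ≥0 :=
  if s.1.2 + 1 < (s.1.1 : ℕ) then (if t.1 = (s.1.1, s.1.2 + 1) then 1 else 0)
  else (if t.1.2 = 0 then lacMass t.1.1 else 0)

lemma hasSum_lacMass : HasSum (fun n : ℕ+ => lacMass n) 1 := by
  rw [← ENNReal.hasSum_coe]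
  have h : ∀ n : ℕ+, (lacMass n : ℝ≥0∞) = lacunary {n} := fun n => by
    rw [coe_lacMass]
    congr 1
    ext k
    simp
  simp_rw [h]
  have := ENNReal.summable (f := fun n : ℕ+ => lacunary {n}).hasSum
  rw [← measure_iUnion (fun i j hij => by simpa using hij) fun i => measurableSet_singleton i,
    Set.iUnion_of_singleton, measure_univ] at this
  simpa using this

lemma hasSum_towerTransition (s : TowerState) : HasSum (towerTransition s) 1 := by
  by_cases h : s.1.2 + 1 < (s.1.1 : ℕ)
  · have := hasSum_single (f := towerTransition s) ⟨(s.1.1, s.1.2 + 1), h⟩ fun t ht => by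
      rw [towerTransition, if_pos h, if_neg fun h' => ht (Subtype.ext h')]
    simpa [towerTransition, h] using this
  · have hinj : Function.Injective fun n : ℕ+ => (⟨(n, 0), n.pos⟩ : TowerState) := fun a b hab => by
      simpa using hab
    rw [← hinj.hasSum_iff]
    · convert! hasSum_lacMass using 2 with n
      simp [towerTransition, h]
    · intro t ht
      rw [towerTransition, if_neg h, if_neg]
      rintro h0
      exact ht ⟨t.1.1, Subtype.ext (Prod.ext rfl h0.symm)⟩

lemma hasSum_lacMass_mul_towerTransition (t : TowerState) :
    HasSum (fun s : TowerState => lacMass s.1.1 * towerTransition s t) (lacMass t.1.1) := by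
  obtain ⟨⟨n, j⟩, hj⟩ := t
  have hj : j < (n : ℕ) := hj
  cases j with
  | zero =>
    have hinj : Function.Injective fun k : ℕ+ =>
        (⟨(k, (k : ℕ) - 1), Nat.sub_lt k.pos one_pos⟩ : TowerState) := fun a b hab => by
      simp only [Subtype.mk.injEq, Prod.mk.injEq] at hab
      exact hab.1
    rw [← hinj.hasSum_iff]
    · have := hasSum_lacMass.mul_right (lacMass n)
      rw [one_mul] at this
      convert! this using 2 with k
      have : ¬ ((k : ℕ) - 1 + 1 < (k : ℕ)) := by lia
      simp [towerTransition, this]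
    · intro s hs
      have h : s.1.2 + 1 < (s.1.1 : ℕ) := by
        by_contra h
        have h2 : s.1.2 < (s.1.1 : ℕ) := s.2
        exact hs ⟨s.1.1, Subtype.ext (Prod.ext rfl (by simp only; lia))⟩
      simp [towerTransition, h]
  | succ j =>
    have := hasSum_single (f := fun s : TowerState =>
      lacMass s.1.1 * towerTransition s ⟨(n, j + 1), hj⟩) ⟨(n, j), by simp only; lia⟩
      fun s hs => by
        have h1 : ¬ ((n, j + 1) = (s.1.1, s.1.2 + 1)) := fun h => by
          simp only [Prod.mk.injEq, Nat.add_right_cancel_iff] at h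
          exact hs (Subtype.ext (Prod.ext h.1.symm h.2.symm))
        simp [towerTransition, h1]
    simpa [towerTransition, hj] using this

/-- The points whose states at times `0, …, n` are `s 0, …, s n`. -/
def towerCylinder (I : Type*) [AddMonoidWithOne I] (n : ℕ) (s : ℕ → TowerState) :
    Set (lacTower I) :=
  {x | ∀ i ≤ n, towerState ((lacMap I)^[i] x) = s i}

lemma measurable_lacMap [IsCancelAdd I] : Measurable (lacMap I) :=
  measurable_towerMap measurable_height measurePreserving_shift.measurable

lemma measurePreserving_lacMap [IsCancelAdd I] :
    MeasurePreserving (lacMap I) (lacMeasure I) (lacMeasure I) :=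
  measurePreserving_towerMap measurable_height measurePreserving_shift

lemma measurableSet_towerCylinder [IsCancelAdd I] (n : ℕ) (s : ℕ → TowerState) :
    MeasurableSet (towerCylinder I n s) := by
  have : towerCylinder I n s =
      ⋂ i ∈ Set.Iic n, (fun x => towerState ((lacMap I)^[i] x)) ⁻¹' {s i} := by
    ext x; simp [towerCylinder]
  rw [this]
  exact .biInter (Set.to_countable _) fun i _ =>
    (measurable_towerState.comp (measurable_lacMap.iterate i)) (measurableSet_singleton _)

lemma towerCylinder_succ (n : ℕ) (s : ℕ → TowerState) :
    towerCylinder I (n + 1) s =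
      {x | towerState x = s 0} ∩ lacMap I ⁻¹' towerCylinder I n fun i => s (i + 1) := by
  ext x
  constructor
  · exact fun h => ⟨h 0 (Nat.zero_le _), fun i hi => h (i + 1) (by lia)⟩
  · rintro ⟨h0, h1⟩ i hi
    cases i with
    | zero => exact h0
    | succ i => exact h1 i (by lia)

lemma lacMeasure_of_subset_state {D : Set (lacTower I)} (hD : MeasurableSet D) {s : TowerState}
    (hs : D ⊆ {x | towerState x = s}) : lacMeasure I D = bernoulliProduct I (slice D s.1.2) := by
  rw [lacMeasure, towerMeasure_apply _ measurable_height hD]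
  refine tsum_eq_single _ fun j hj => ?_
  convert! measure_empty (μ := bernoulliProduct I)
  refine Set.eq_empty_of_forall_notMem fun ω ⟨h, hω⟩ => hj ?_
  have h1 : towerState _ = s := hs hω
  rw [← h1]
  rfl

lemma slice_inter_state (D : Set (lacTower I)) (s : TowerState) :
    slice ({x | towerState x = s} ∩ D) s.1.2 = {ω | height I ω = s.1.1} ∩ slice D s.1.2 := by
  ext ω
  constructor
  · rintro ⟨h, h1, h2⟩
    exact ⟨congrArg (fun s : TowerState => s.1.1) h1, h, h2⟩
  · rintro ⟨h1, h, h2⟩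
    exact ⟨h, Subtype.ext (Prod.ext h1 rfl), h2⟩

/-- Prepending the state `s` to an event contained in the state `t` multiplies its measure by a
factor `r` which is the backward transition weight from `t` to `s`. -/
lemma exists_lacMeasure_state_inter_preimage (s t : TowerState) :
    ∃ r : ℝ≥0, lacMass s.1.1 * towerTransition s t = r * lacMass t.1.1 ∧
      ∀ D : Set (lacTower ℕ), MeasurableSet D → D ⊆ {x | towerState x = t} →
        lacMeasure ℕ ({x | towerState x = s} ∩ lacMap ℕ ⁻¹' D) = r * lacMeasure ℕ D := by
  have hm : ∀ D : Set (lacTower ℕ), MeasurableSet D →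
      lacMeasure ℕ ({x | towerState x = s} ∩ lacMap ℕ ⁻¹' D) =
        bernoulliProduct ℕ ({ω | height ℕ ω = s.1.1} ∩ (slice D (s.1.2 + 1) ∪
          {ω | (height ℕ ω : ℕ) = s.1.2 + 1} ∩ shift ℕ ⁻¹' slice D 0)) := by
    intro D hD
    have hs : MeasurableSet {x : lacTower ℕ | towerState x = s} :=
      measurable_towerState (measurableSet_singleton s)
    rw [lacMeasure_of_subset_state (hs.inter (measurable_lacMap hD)) Set.inter_subset_left,
      ← slice_preimage, ← slice_inter_state]
    rfl
  by_cases h : s.1.2 + 1 < (s.1.1 : ℕ)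
  · by_cases ht : t.1 = (s.1.1, s.1.2 + 1)
    · refine ⟨1, by simp [towerTransition, h, ht], fun D hD hsub => ?_⟩
      rw [hm D hD, lacMeasure_of_subset_state hD hsub, ENNReal.coe_one, one_mul, ht]
      congr 1
      ext ω
      constructor
      · rintro ⟨h1, h2 | ⟨h2, _⟩⟩
        · exact h2
        · have h1 : height ℕ ω = s.1.1 := h1
          have h2 : (height ℕ ω : ℕ) = s.1.2 + 1 := h2
          rw [h1] at h2
          lia
      · rintro ⟨h1, h2⟩
        have h3 : towerState _ = t := hsub h2
        have h4 : height ℕ ω = t.1.1 := congrArg (fun s : TowerState => s.1.1) h3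
        exact ⟨by rw [Set.mem_ofPred_eq, h4, ht], Or.inl ⟨h1, h2⟩⟩
    · refine ⟨0, by simp [towerTransition, h, ht], fun D hD hsub => ?_⟩
      rw [hm D hD, ENNReal.coe_zero, zero_mul]
      convert! measure_empty (μ := bernoulliProduct ℕ)
      refine Set.eq_empty_of_forall_notMem ?_
      rintro ω ⟨h1, ⟨h2, h3⟩ | ⟨h2, _⟩⟩
      · have h1 : height ℕ ω = s.1.1 := h1
        have h4 : towerState _ = t := hsub h3
        rw [← h4] at ht
        exact ht (Prod.ext h1 rfl)
      · have h1 : height ℕ ω = s.1.1 := h1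
        have h2 : (height ℕ ω : ℕ) = s.1.2 + 1 := h2
        rw [h1] at h2
        lia
  · have hs : (s.1.1 : ℕ) = s.1.2 + 1 := by
      have : s.1.2 < (s.1.1 : ℕ) := s.2
      lia
    have hm' : ∀ D : Set (lacTower ℕ), MeasurableSet D →
        lacMeasure ℕ ({x | towerState x = s} ∩ lacMap ℕ ⁻¹' D) =
          lacMass s.1.1 * bernoulliProduct ℕ (slice D 0) := by
      intro D hD
      rw [hm D hD, ← bernoulliProduct_inter_shift_preimage _ (measurableSet_slice measurable_height hD 0)]
      congr 1
      ext ω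
      constructor
      · rintro ⟨h1, ⟨h2, _⟩ | ⟨h2, h3⟩⟩
        · have h1 : height ℕ ω = s.1.1 := h1
          rw [h1] at h2
          lia
        · exact ⟨by rw [Set.mem_ofPred_eq, hs]; exact h2, h3⟩
      · rintro ⟨h1, h2⟩
        have h1 : (height ℕ ω : ℕ) = s.1.1 := h1
        exact ⟨PNat.coe_injective h1, Or.inr ⟨h1.trans hs, h2⟩⟩
    by_cases ht : t.1.2 = 0
    · refine ⟨lacMass s.1.1, by simp [towerTransition, h, ht], fun D hD hsub => ?_⟩
      rw [hm' D hD, lacMeasure_of_subset_state hD hsub, ht]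
    · refine ⟨0, by simp [towerTransition, h, ht], fun D hD hsub => ?_⟩
      have : slice D 0 = ∅ := by
        refine Set.eq_empty_of_forall_notMem fun ω ⟨h1, h2⟩ => ht ?_
        have h3 : towerState _ = t := hsub h2
        rw [← h3]
        rfl
      rw [hm' D hD, this]
      simp

lemma lacMeasure_towerCylinder (n : ℕ) (s : ℕ → TowerState) :
    lacMeasure ℕ (towerCylinder ℕ n s) =
      ((lacMass (s 0).1.1 * ∏ i ∈ Finset.range n, towerTransition (s i) (s (i + 1)) : ℝ≥0) :
        ℝ≥0∞) := by
  induction n generalizing s with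
  | zero =>
    have h0 : towerCylinder ℕ 0 s = {x | towerState x = s 0} ∩ Set.univ := by
      ext x; simp [towerCylinder]
    rw [lacMeasure_of_subset_state (measurableSet_towerCylinder 0 s)
      (fun x hx => hx 0 le_rfl), h0, slice_inter_state]
    have : {ω : ℕ → ℕ+ | height ℕ ω = (s 0).1.1} ∩ slice (Set.univ : Set (lacTower ℕ)) (s 0).1.2 =
        {ω | (height ℕ ω : ℕ) = (s 0).1.1} ∩ shift ℕ ⁻¹' Set.univ := by
      ext ω
      constructor
      · rintro ⟨h1, _⟩
        exact ⟨congrArg _ h1, trivial⟩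
      · rintro ⟨h1, _⟩
        have h1 : height ℕ ω = (s 0).1.1 := PNat.coe_injective h1
        exact ⟨h1, by rw [h1]; exact (s 0).2, trivial⟩
    rw [this, bernoulliProduct_inter_shift_preimage _ MeasurableSet.univ]
    simp
  | succ n ih =>
    obtain ⟨r, hr, hD⟩ := exists_lacMeasure_state_inter_preimage (s 0) (s 1)
    have hsub : (towerCylinder ℕ n fun i => s (i + 1)) ⊆ {x | towerState x = s 1} :=
      fun x hx => hx 0 (Nat.zero_le _)
    rw [towerCylinder_succ, hD _ (measurableSet_towerCylinder _ _) hsub,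
      ih, Finset.prod_range_succ', mul_comm (∏ _ ∈ _, _), ← mul_assoc, hr]
    push_cast
    ring

/-- The states along the forward orbit of a point determine its nonnegative coordinates. -/
lemma apply_natCast_eq_of_towerState_eq (n : ℕ) {x y : lacTower I}
    (h : ∀ i : ℕ, towerState ((lacMap I)^[i] x) = towerState ((lacMap I)^[i] y)) :
    x.1.1 (n : I) = y.1.1 (n : I) := by
  have h0 : height I x.1.1 = height I y.1.1 := congrArg (fun s : TowerState => s.1.1) (h 0)
  induction n generalizing x y with
  | zero => simpa [height] using h0
  | succ n ih =>
    have hlev : x.1.2 = y.1.2 := congrArg (fun s : TowerState => s.1.2) (h 0)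
    have hx := towerMap_iterate_exit (S := shift I) x
    have hy := towerMap_iterate_exit (S := shift I) y
    rw [← h0, ← hlev] at hy
    have h' : ∀ i : ℕ, towerState ((lacMap I)^[i] (basePt (height I) (shift I x.1.1))) =
        towerState ((lacMap I)^[i] (basePt (height I) (shift I y.1.1))) := by
      intro i
      rw [← hx, ← hy]
      simp only [lacMap, ← Function.iterate_add_apply]
      exact h _
    have := ih h' (congrArg (fun s : TowerState => s.1.1) (h' 0))
    simpa [basePt, shift] using this

instance [Countable I] : StandardBorelSpace (lacTower I) :=
  (measurableSet_tower (measurable_height (I := I))).standardBorel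

instance : Nonempty (lacTower I) := ⟨basePt (height I) fun _ => 1⟩

end Coding

section OneSided

/-- The sequence of states along the forward orbit. -/
def forwardCoding (x : lacTower ℕ) (i : ℕ) : TowerState := towerState ((lacMap ℕ)^[i] x)

lemma measurable_forwardCoding : Measurable forwardCoding :=
  measurable_pi_lambda _ fun i => measurable_towerState.comp (measurable_lacMap.iterate i)

lemma forwardCoding_injective : Function.Injective forwardCoding := by
  intro x y h
  have h' : ∀ i : ℕ, towerState ((lacMap ℕ)^[i] x) = towerState ((lacMap ℕ)^[i] y) := congrFun h
  refine Subtype.ext (Prod.ext (funext fun n => ?_) ?_)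
  · simpa using apply_natCast_eq_of_towerState_eq n h'
  · exact congrArg (fun s : TowerState => s.1.2) (h' 0)

lemma isMarkovShift_lacMap_nat : IsMarkovShift ℕ (lacMap ℕ) (lacMeasure ℕ) := by
  refine ⟨TowerState, inferInstance, inferInstance, inferInstance, towerTransition,
    fun s => lacMass s.1.1, (lacMeasure ℕ).map forwardCoding,
    ⟨hasSum_towerTransition, hasSum_lacMass_mul_towerTransition, fun k n s => ?_⟩,
    isIsomorphic_shift_of_injective measurable_forwardCoding forwardCoding_injective fun x => ?_⟩
  · simp only [Nat.cast_id]
    have hm : MeasurableSet {x : ℕ → TowerState | ∀ i : ℕ, i ≤ n → x (k + i) = s i} := by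
      simp only [Set.ofPred_forall]
      exact .iInter fun i => .iInter fun _ => measurable_pi_apply (k + i) (measurableSet_singleton _)
    rw [← lacMeasure_towerCylinder, Measure.map_apply measurable_forwardCoding hm,
      ← (measurePreserving_lacMap.iterate k).measure_preimage
        (measurableSet_towerCylinder n s).nullMeasurableSet]
    congr 1
    ext x
    simp only [Set.mem_preimage, towerCylinder, Set.mem_ofPred_eq, forwardCoding,
      ← Function.iterate_add_apply, add_comm k]
  · rfl

end OneSided

section TwoSided

lemma lacMap_int_injective : Function.Injective (lacMap ℤ) := by
  intro x y hxy
  have hx := x.2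
  have hy := y.2
  have hshift : Function.Injective (shift ℤ : (ℤ → ℕ+) → ℤ → ℕ+) := fun a b hab => by
    ext i
    have := congrFun hab (i - 1)
    simpa [shift] using congrArg PNat.val this
  by_cases h1 : x.1.2 + 1 < (height ℤ x.1.1 : ℕ) <;>
    by_cases h2 : y.1.2 + 1 < (height ℤ y.1.1 : ℕ)
  · rw [lacMap, towerMap_of_lt h1, towerMap_of_lt h2] at hxy
    simp only [Subtype.mk.injEq, Prod.mk.injEq, Nat.add_right_cancel_iff] at hxy
    exact Subtype.ext (Prod.ext hxy.1 hxy.2)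
  · rw [lacMap, towerMap_of_lt h1, towerMap_of_not_lt h2] at hxy
    simp [basePt] at hxy
  · rw [lacMap, towerMap_of_not_lt h1, towerMap_of_lt h2] at hxy
    simp [basePt] at hxy
  · rw [lacMap, towerMap_of_not_lt h1, towerMap_of_not_lt h2] at hxy
    simp only [basePt, Subtype.mk.injEq, Prod.mk.injEq, and_true] at hxy
    have h3 := hshift hxy
    refine Subtype.ext (Prod.ext h3 ?_)
    rw [h3] at h1 hx
    lia

/-- The point at the top level above the preceding base point. -/
def precedingTop (ω : ℤ → ℕ+) : lacTower ℤ :=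
  ⟨(fun i => ω (i - 1), (ω (-1) : ℕ) - 1), by
    have := (ω (-1)).pos
    simp only [height, zero_sub]
    lia⟩

lemma lacMap_precedingTop (ω : ℤ → ℕ+) : lacMap ℤ (precedingTop ω) = basePt (height ℤ) ω := by
  rw [lacMap, towerMap_of_not_lt]
  · congr 1
    ext i
    simp [precedingTop, shift]
  · simp only [precedingTop, height, zero_sub]
    lia

lemma lacMap_iterate_precedingTop (x : lacTower ℤ) :
    (lacMap ℤ)^[x.1.2 + 1] (precedingTop x.1.1) = x := by
  rw [Function.iterate_succ_apply, lacMap_precedingTop, lacMap,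
    towerMap_iterate_of_lt _ _ (by simpa [basePt] using x.2)]
  simp [basePt]

lemma lacMap_int_surjective : Function.Surjective (lacMap ℤ) := fun x =>
  ⟨(lacMap ℤ)^[x.1.2] (precedingTop x.1.1), by
    rw [← Function.iterate_succ_apply' (lacMap ℤ)]; exact lacMap_iterate_precedingTop x⟩

/-- The two-sided tower map as a permutation. -/
noncomputable def lacPerm : Equiv.Perm (lacTower ℤ) :=
  Equiv.ofBijective (lacMap ℤ) ⟨lacMap_int_injective, lacMap_int_surjective⟩

lemma lacPerm_zpow_natCast (n : ℕ) (x : lacTower ℤ) :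
    (lacPerm ^ (n : ℤ)) x = (lacMap ℤ)^[n] x := by
  rw [zpow_natCast, ← Equiv.Perm.iterate_eq_pow]
  rfl

lemma measurable_lacPerm_zpow (k : ℤ) : Measurable (lacPerm ^ k : Equiv.Perm (lacTower ℤ)) := by
  have hnat : ∀ n : ℕ, Measurable (lacPerm ^ (n : ℤ) : Equiv.Perm (lacTower ℤ)) := fun n => by
    rw [show (⇑(lacPerm ^ (n : ℤ)) : lacTower ℤ → lacTower ℤ) = (lacMap ℤ)^[n] from
      funext (lacPerm_zpow_natCast n)]
    exact measurable_lacMap.iterate n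
  obtain ⟨n, rfl | rfl⟩ := k.eq_nat_or_neg
  · exact hnat n
  · intro A hA
    have : (lacPerm ^ (-(n : ℤ)) : Equiv.Perm (lacTower ℤ)) ⁻¹' A =
        (lacPerm ^ (n : ℤ) : Equiv.Perm (lacTower ℤ)) '' A := by
      rw [zpow_neg, Equiv.image_eq_preimage_symm]
      rfl
    rw [this]
    exact ((hnat n).measurableEmbedding (Equiv.injective _)).measurableSet_image.2 hA

lemma lacMeasure_preimage_lacPerm_zpow (k : ℤ) {A : Set (lacTower ℤ)} (hA : MeasurableSet A) :
    lacMeasure ℤ ((lacPerm ^ k : Equiv.Perm (lacTower ℤ)) ⁻¹' A) = lacMeasure ℤ A := by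
  have hnat : ∀ (n : ℕ) {A : Set (lacTower ℤ)}, MeasurableSet A →
      lacMeasure ℤ ((lacPerm ^ (n : ℤ) : Equiv.Perm (lacTower ℤ)) ⁻¹' A) = lacMeasure ℤ A := by
    intro n A hA
    rw [show (⇑(lacPerm ^ (n : ℤ)) : lacTower ℤ → lacTower ℤ) = (lacMap ℤ)^[n] from
      funext (lacPerm_zpow_natCast n)]
    exact (measurePreserving_lacMap.iterate n).measure_preimage hA.nullMeasurableSet
  obtain ⟨n, rfl | rfl⟩ := k.eq_nat_or_neg
  · exact hnat n hA
  · rw [← hnat n (measurable_lacPerm_zpow _ hA), ← Set.preimage_comp, ← Equiv.Perm.coe_mul,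
      ← zpow_add, neg_add_cancel, zpow_zero]
    rfl

/-- The sequence of states along the full orbit. -/
noncomputable def orbitCoding (x : lacTower ℤ) (i : ℤ) : TowerState :=
  towerState ((lacPerm ^ i : Equiv.Perm (lacTower ℤ)) x)

lemma measurable_orbitCoding : Measurable orbitCoding :=
  measurable_pi_lambda _ fun i => measurable_towerState.comp (measurable_lacPerm_zpow i)

lemma orbitCoding_zpow (x : lacTower ℤ) (k i : ℤ) :
    orbitCoding ((lacPerm ^ k : Equiv.Perm (lacTower ℤ)) x) i = orbitCoding x (i + k) := by
  rw [orbitCoding, orbitCoding, zpow_add]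
  rfl

/-- The states along the full orbit determine the past: going back to the top level above the
preceding base point moves the coordinate `-n - 1` to `-n`. -/
lemma apply_neg_natCast_eq_of_orbitCoding_eq (n : ℕ) {x y : lacTower ℤ}
    (h : orbitCoding x = orbitCoding y) : x.1.1 (-(n : ℤ)) = y.1.1 (-(n : ℤ)) := by
  have h0 : towerState x = towerState y := congrFun h 0
  induction n generalizing x y with
  | zero =>
    have : height ℤ x.1.1 = height ℤ y.1.1 := congrArg (fun s : TowerState => s.1.1) h0
    simpa [height] using this
  | succ n ih =>
    have hlev : x.1.2 = y.1.2 := congrArg (fun s : TowerState => s.1.2) h0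
    have hback : ∀ z : lacTower ℤ, orbitCoding (precedingTop z.1.1) =
        fun i => orbitCoding z (i + -((z.1.2 + 1 : ℕ) : ℤ)) := by
      intro z
      funext i
      have hz : (lacPerm ^ ((z.1.2 + 1 : ℕ) : ℤ)) (precedingTop z.1.1) = z :=
        (lacPerm_zpow_natCast _ _).trans (lacMap_iterate_precedingTop z)
      have := orbitCoding_zpow (precedingTop z.1.1) ((z.1.2 + 1 : ℕ) : ℤ)
        (i + -((z.1.2 + 1 : ℕ) : ℤ))
      rw [hz, neg_add_cancel_right] at this
      exact this.symm
    have h' : orbitCoding (precedingTop x.1.1) = orbitCoding (precedingTop y.1.1) := by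
      rw [hback, hback, h, hlev]
    have := ih h' (congrFun h' 0)
    simp only [precedingTop] at this
    rw [Nat.cast_succ, neg_add]
    exact this

lemma orbitCoding_injective : Function.Injective orbitCoding := by
  intro x y h
  refine Subtype.ext (Prod.ext (funext fun k => ?_) ?_)
  · obtain ⟨n, rfl | rfl⟩ := k.eq_nat_or_neg
    · refine apply_natCast_eq_of_towerState_eq n fun i => ?_
      rw [← lacPerm_zpow_natCast, ← lacPerm_zpow_natCast]
      exact congrFun h i
    · exact apply_neg_natCast_eq_of_orbitCoding_eq n h
  · exact congrArg (fun s : TowerState => s.1.2) (congrFun h 0)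

lemma towerCylinder_int (n : ℕ) (s : ℕ → TowerState) :
    towerCylinder ℤ n s = forgetPast ⁻¹' towerCylinder ℕ n s := by
  have hiter : ∀ i x, forgetPast ((lacMap ℤ)^[i] x) = (lacMap ℕ)^[i] (forgetPast x) := fun i =>
    Function.Semiconj.iterate_right (f := forgetPast) (fun x => forgetPast_lacMap x) i
  ext x
  simp only [towerCylinder, Set.mem_ofPred_eq, Set.mem_preimage, ← hiter]
  rfl

lemma isMarkovShift_lacMap_int : IsMarkovShift ℤ (lacMap ℤ) (lacMeasure ℤ) := by
  refine ⟨TowerState, inferInstance, inferInstance, inferInstance, towerTransition,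
    fun s => lacMass s.1.1, (lacMeasure ℤ).map orbitCoding,
    ⟨hasSum_towerTransition, hasSum_lacMass_mul_towerTransition, fun k n s => ?_⟩,
    isIsomorphic_shift_of_injective measurable_orbitCoding orbitCoding_injective fun x => ?_⟩
  · have hm : MeasurableSet {x : ℤ → TowerState | ∀ i : ℕ, i ≤ n → x (k + (i : ℤ)) = s i} := by
      simp only [Set.ofPred_forall]
      exact .iInter fun i => .iInter fun _ =>
        measurable_pi_apply (k + (i : ℤ)) (measurableSet_singleton _)
    rw [← lacMeasure_towerCylinder, Measure.map_apply measurable_orbitCoding hm,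
      ← measurePreserving_forgetPast.measure_preimage
        (measurableSet_towerCylinder n s).nullMeasurableSet, ← towerCylinder_int,
      ← lacMeasure_preimage_lacPerm_zpow k (measurableSet_towerCylinder n s)]
    congr 1
    ext x
    simp only [Set.mem_preimage, towerCylinder, Set.mem_ofPred_eq, ← lacPerm_zpow_natCast]
    refine forall₂_congr fun i _ => ?_
    rw [add_comm, ← orbitCoding_zpow]
    rfl
  · funext i
    have := orbitCoding_zpow x 1 i
    rwa [zpow_one] at this

end TwoSided

end InfiniteErgodic

theorem mainTheorem12 :
    -- the one-sided tower
    (SigmaFinite (lacMeasure ℕ) ∧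
      Conservative (lacMap ℕ) (lacMeasure ℕ) ∧
      Ergodic (lacMap ℕ) (lacMeasure ℕ) ∧
      IsMarkovShift ℕ (lacMap ℕ) (lacMeasure ℕ) ∧
      QuasiFinite (lacMap ℕ) (lacMeasure ℕ) ∧
      (∃ a : ℕ → ℝ,
        IsReturnSequence (lacMap ℕ)
          (lacMeasure ℕ) a ∧
        a =Θ[atTop] fun n : ℕ => Real.sqrt (Real.log n)) ∧
      ¬ LogLowerBounded (lacMap ℕ)
          (lacMeasure ℕ)) ∧
    -- the two-sided tower, an extension of the one-sided one
    (SigmaFinite (lacMeasure ℤ) ∧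
      Conservative (lacMap ℤ) (lacMeasure ℤ) ∧
      Ergodic (lacMap ℤ) (lacMeasure ℤ) ∧
      IsMarkovShift ℤ (lacMap ℤ) (lacMeasure ℤ) ∧
      QuasiFinite (lacMap ℤ) (lacMeasure ℤ) ∧
      IsFactor (lacMap ℤ) (lacMeasure ℤ)
        (lacMap ℕ) (lacMeasure ℕ) ∧
      ¬ LogLowerBounded (lacMap ℤ)
          (lacMeasure ℤ)) := by
  exact ⟨⟨inferInstance, conservative_lacMap, ergodic_lacMap, isMarkovShift_lacMap_nat,
      quasiFinite_lacMap, ⟨_, isReturnSequence_renewalSum, renewalSum_isTheta⟩,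
      not_logLowerBounded_lacMap⟩,
    inferInstance, conservative_lacMap, ergodic_lacMap, isMarkovShift_lacMap_int,
    quasiFinite_lacMap, ⟨forgetPast, measurePreserving_forgetPast,
      Eventually.of_forall forgetPast_lacMap⟩, not_logLowerBounded_lacMap⟩
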